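/- Let $q\ge 0$ be an integer and let $A_1,\dots,A_{q+1},B_1,\dots,B_q\in\mathbb{C}$ satisfy $B_j\notin\{0,-1,-2,\dots\}$ for all $j$ and $A_i-A_j\notin\mathbb{Z}$ for $i\ne j$. For $|y|<1$ let $${}_{q+1}F_q(A;B;y)=\sum_{n\ge 0}\frac{\prod_{i=1}^{q+1}(A_i)_n}{\prod_{j=1}^{q}(B_j)_n}\,\frac{y^n}{n!} =\frac{\prod_{j}\Gamma(B_j)}{\prod_{i}\Gamma(A_i)}\sum_{n\ge0}\frac{\prod_i\Gamma(A_i+n)}{\prod_j\Gamma(B_j+n)}\,\frac{y^n}{n!}$$ (the second expression being valid if no $A_i$ is a non-positive integer), where $(a)_n=a(a+1)\cdots(a+n-1)$, and put $$c_k=\prod_{j=1}^{q}\frac{\Gamma(B_j)}{\Gamma(B_j-A_k)}\prod_{j\neq k}\frac{\Gamma(A_j-A_k)}{\Gamma(A_j)},\qquad k=1,\dots,q+1,$$ where $1/\Gamma$ is the entire reciprocal Gamma function, which vanishes at $0,-1,-2,\dots$. Then there are functions $\varepsilon_1,\dots,\varepsilon_{q+1}$, depending only on $A$ and $B$, holomorphic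 near $0\in\mathbb{C}$, with $\varepsilon_k(w)=O(w)$ as $w\to0$, such that the following holds. Let $\rho:\mathbb{R}\to\mathbb{C}\setminus\{0,1\}$ be a continuous path from $0$ to $\infty$ (that is, $\rho(t)\to0$ as $t\to-\infty$ and $\rho(t)\to\infty$ as $t\to+\infty$) with trivial winding around $0$ and $1$, in the sense that $\rho$ can be deformed to the negative real axis $t\mapsto-e^t$ by a homotopy in $\mathbb{C}\setminus\{0,1\}$ through paths from $0$ to $\infty$ (the limits at both ends being uniform in the deformation parameter). Then ${}_{q+1}F_q(A;B;y)$ has an analytic continuation along $\rho$; a continuous branch $L$ of $\log(-y)$ along $\rho$ is obtained by continuity along such a deformation from the branch that is real on the negative real axis; and for every analytic continuation of ${}_{q+1}F_q(A;B;\cdot)$ along $\rho$ and every such branch $L$, the value $\widetilde F(t)$ of the continuation at $y=\rho(t)$ satisfies, for all sufficiently large $t$, $$\widetilde F(t)=\sum_{k=1}^{q+1}c_k\,(-y)^{-A_k}\bigl(1+\varepsilon_k(1/y)\bigr),\qquad y=\rho(t),\quad (-y)^{-A_k}=e^{-A_kL(t)},$$ so that $\widetilde F\sim\sum_k c_k(-y)^{-A_k}\bigl(1+O(1/y)\bigr)$.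 -/

import Mathlib

open Filter Topology

/-- The generalized hypergeometric function `ₚF_q`, i.e. the sum of its series: Mathlib's
regularized function, whose coefficients are divided by `∏_j Γ(B_j)`, multiplied by that constant.
`genHyp_eq_Gamma` gives the series with quotients of Gamma functions. -/
noncomputable def genHyp {p q : ℕ} (A : Fin p → ℂ) (B : Fin q → ℂ) (w : ℂ) : ℂ :=
  (∏ j, Complex.Gamma (B j)) *
    Complex.regularizedHGFun (Finset.univ.val.map A) (Finset.univ.val.map B) w

theorem genHyp_eq_Gamma {p q : ℕ} (A : Fin p → ℂ) (B : Fin q → ℂ) (w : ℂ)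
    (hA : ∀ i, ∀ m : ℕ, A i ≠ -m) :
    genHyp A B w = (∏ j, Complex.Gamma (B j)) / (∏ i, Complex.Gamma (A i)) *
      ∑' n : ℕ, (∏ i, Complex.Gamma (A i + n)) / (∏ j, Complex.Gamma (B j + n)) *
        (w ^ n / (n.factorial : ℂ)) := by
  rw [genHyp, div_mul_eq_mul_div, mul_div_assoc, Complex.regularizedHGFun,
    Complex.regularizedHGFunSeries, ← tsum_div_const]
  congr 1
  rw [← FormalMultilinearSeries.ofScalarsSum, FormalMultilinearSeries.ofScalarsSum_eq_tsum]
  refine tsum_congr fun n => ?_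
  have h : (∏ i, (ascPochhammer ℂ n).eval (A i)) =
      (∏ i, Complex.Gamma (A i + n)) / ∏ i, Complex.Gamma (A i) := by
    rw [← Finset.prod_div_distrib]
    exact Finset.prod_congr rfl fun i _ => (Complex.Gamma_add_nat_div_Gamma_eq (A i) (hA i)).symm
  simp only [Complex.regularizedHGFunCoeff, Multiset.map_map, smul_eq_mul]
  change (∏ i, (ascPochhammer ℂ n).eval (A i)) / (_ * ∏ j, Complex.Gamma (B j + n)) * _ = _
  rw [h]
  simp only [div_eq_mul_inv, mul_inv]
  ring

/-- The connection coefficient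
`∏_j Γ(B_j) / Γ(B_j - A_k) * ∏_{j ≠ k} Γ(A_j - A_k) / Γ(A_j)`. Mathlib's `Gamma` is `0` at its
poles and `x / 0 = 0`, so that `1 / Γ` is the entire reciprocal Gamma function. -/
noncomputable def connCoeff {q : ℕ} (A : Fin (q + 1) → ℂ) (B : Fin q → ℂ) (k : Fin (q + 1)) : ℂ :=
  (∏ j, Complex.Gamma (B j) / Complex.Gamma (B j - A k)) *
    ∏ j ∈ Finset.univ.erase k, Complex.Gamma (A j - A k) / Complex.Gamma (A j)

/-- A path in `ℂ ∖ {0, 1}` that runs from `0` to `∞`. -/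
structure IsPathZeroInfty (ρ : ℝ → ℂ) : Prop where
  cont : Continuous ρ
  ne_zero : ∀ t, ρ t ≠ 0
  ne_one : ∀ t, ρ t ≠ 1
  start : Tendsto ρ atBot (𝓝 0)
  finish : Tendsto ρ atTop (Bornology.cobounded ℂ)

/-- `H`, on `[0, 1] × ℝ`, is a homotopy in `ℂ ∖ {0, 1}` from the negative real axis
`t ↦ -exp t` to `ρ`, through paths that run from `0` to `∞` (the ends being attained uniformly in
the deformation parameter, so that `H` extends continuously to `[0, 1] × [-∞, ∞]` with values in
the Riemann sphere). -/
structure IsDeformation (ρ : ℝ → ℂ) (H : ℝ × ℝ → ℂ) : Prop where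
  cont : ContinuousOn H (Set.Icc 0 1 ×ˢ Set.univ)
  ne_zero : ∀ s ∈ Set.Icc (0 : ℝ) 1, ∀ t, H (s, t) ≠ 0
  ne_one : ∀ s ∈ Set.Icc (0 : ℝ) 1, ∀ t, H (s, t) ≠ 1
  init : ∀ t, H (0, t) = -Complex.exp t
  term : ∀ t, H (1, t) = ρ t
  start : Tendsto H (𝓟 (Set.Icc 0 1) ×ˢ atBot) (𝓝 0)
  finish : Tendsto H (𝓟 (Set.Icc 0 1) ×ˢ atTop) (Bornology.cobounded ℂ)

/-- The path does not wind around `0` and `1`: it can be deformed in `ℂ ∖ {0, 1}` to the negative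
real axis. -/
def HasTrivialWinding (ρ : ℝ → ℂ) : Prop :=
  ∃ H, IsDeformation ρ H

/-- `L` is the branch of `log (-y)` along `ρ` that is obtained from the real logarithm on the
negative real axis by continuity along a deformation of the negative real axis to `ρ`. -/
def IsLogNegBranch (ρ L : ℝ → ℂ) : Prop :=
  ∃ H ℓ : ℝ × ℝ → ℂ, IsDeformation ρ H ∧
    ContinuousOn ℓ (Set.Icc 0 1 ×ˢ Set.univ) ∧
    (∀ s ∈ Set.Icc (0 : ℝ) 1, ∀ t, Complex.exp (ℓ (s, t)) = -H (s, t)) ∧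
    (∀ t : ℝ, ℓ (0, t) = t) ∧ ∀ t, ℓ (1, t) = L t

/-- `F` is an analytic continuation along `ρ` of the function `f` defined near `0 = ρ (-∞)`:
`F t` is an analytic germ at `ρ t`, the germs fit together, and they are those of `f` at the
beginning of the path. -/
structure IsContinuationAlong (f : ℂ → ℂ) (ρ : ℝ → ℂ) (F : ℝ → ℂ → ℂ) : Prop where
  analytic : ∀ t, AnalyticAt ℂ (F t) (ρ t)
  compat : ∀ t, ∀ᶠ s in 𝓝 t, F s =ᶠ[𝓝 (ρ s)] F t
  init : ∀ᶠ t in atBot, F t =ᶠ[𝓝 (ρ t)] f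

/-!
The hypergeometric series solves the Fuchsian equation `θ ∏ (θ + B_j - 1) f = y ∏ (θ + A_i) f`,
`θ = y d/dy`, which is regular on `ℂ ∖ {0, 1}`. Since no two of the `A_k` differ by an integer, the
equation has near `∞` the solutions `(-y)^(-A_k) (1 + ε_k(1 / y))`, where `1 + ε_k` is again a
hypergeometric series, in `1 / y`. They are linearly independent, because the monodromy around `∞`
has the distinct eigenvalues `exp (-2πi A_k)` on them (`NonResonant.linearIndependent_infJet`).

*Continuation.* The equation is treated as a first order system `Y' = M Y`, and continuations of
solutions along a map `h` from a space `T` as sections `σ` over `T` that are locally of the form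
`Y ∘ h` with `Y` a solution (`FlatAlong`). The germs of solutions form a covering space of
`ℂ ∖ {0, 1}`, so that such a section with a prescribed value exists if `T` is simply connected
(`exists_flatAlong`), and it is unique if `T` is connected (`FlatAlong.eq`). Taking for `T` the
domain `[0, 1] × ℝ` of a deformation (extended to the plane by `retract`) reduces the claim for `ρ`
to the claim for the negative real axis: near the end `t = -∞` the section is given by the series on the whole strip, near the end
`t = +∞` by one combination of the solutions at infinity, and the coefficients can be read off on
the side that is the negative real axis (`NonResonant.exists_flatAlong_deformation`).

*The coefficients.* On the slit plane, with the coordinate `u = log (-y)` in `|Im u| < π`, the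
coefficients are computed by induction on `q` (`NonResonant.connectionFormula`). For `q = 0` the
series is `(1 - y)^(-A_0)`. The relations `(θ + B_j) F(A; B + e_j) = B_j F(A; B)` and
`(θ + A_i) F(A; B) = A_i F(A + e_i; B)` hold for the coefficients as for the quotients of Gamma
functions, so that for the `k`-th coefficient one may assume that all the other `A_i` have large
real parts, and that the last `B_j` has a real part larger still. Then `F` is, up to a constant factor, an Euler integral
`∫ t^(a-1) (1-t)^(b-a-1) F'(t y) dt` over a hypergeometric function `F'` with one pair of
parameters less, and the `k`-th coefficient of either function is the limit of `(-y)^(A_k) F(y)`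
along the negative real axis, with which the integral can be exchanged by dominated convergence
(`connectionFormula_of_succAbove`).
-/

namespace GenHyp

/-! ### Linear differential equations in the complex domain -/

section LinearODE

open Metric

variable {V : Type*} [NormedAddCommGroup V] [NormedSpace ℂ V]

/-- `Y` solves the linear equation `Y' = M Y` at the point `z`. -/
def SolvesAt (M : ℂ → V →L[ℂ] V) (Y : ℂ → V) (z : ℂ) : Prop :=
  HasDerivAt Y (M z (Y z)) z

/-- Picard's iteration. The equation being linear, the solution is the sum of the successive
corrections, each of which is the primitive of `M` applied to the one before. -/
theorem exists_solvesAt_ball [CompleteSpace V] {M : ℂ → V →L[ℂ] V} {c : ℂ} {r K : ℝ} (hr : 0 < r)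
    (hM : DifferentiableOn ℂ M (ball c r)) (hK : ∀ w ∈ ball c r, ‖M w‖ ≤ K)
    (hKr : K * r ≤ 1 / 2) (v : V) :
    ∃ Y : ℂ → V, Y c = v ∧ ∀ w ∈ ball c r, SolvesAt M Y w := by
  have step : ∀ g : ℂ → V, DifferentiableOn ℂ g (ball c r) →
      ∃ g' : ℂ → V, g' c = 0 ∧ ∀ w ∈ ball c r, HasDerivAt g' (M w (g w)) w := fun g hg =>
    Complex.IsExactOn.with_val_at (DifferentiableOn.isExactOn_ball (hM.clm_apply hg)) c 0
  choose! T hT0 hT using step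
  have hc : c ∈ ball c r := mem_ball_self hr
  have hK0 : 0 ≤ K := (norm_nonneg _).trans (hK c hc)
  set g : ℕ → ℂ → V := fun n => T^[n] fun _ => v with hg
  have gs : ∀ n, g (n + 1) = T (g n) := fun n => by simp [hg, Function.iterate_succ_apply']
  have gd : ∀ n, DifferentiableOn ℂ (g n) (ball c r) := by
    intro n
    induction n with
    | zero => exact differentiableOn_const v
    | succ n ih =>
      rw [gs]
      exact fun w hw => (hT _ ih w hw).differentiableAt.differentiableWithinAt
  have gb : ∀ n, ∀ w ∈ ball c r, ‖g n w‖ ≤ ‖v‖ * (1 / 2) ^ n := by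
    intro n
    induction n with
    | zero => intro w _; simp [hg]
    | succ n ih =>
      intro w hw
      rw [gs]
      have := (convex_ball c r).norm_image_sub_le_of_norm_hasDerivWithin_le
        (fun x hx => (hT _ (gd n) x hx).hasDerivWithinAt)
        (fun x hx => ((M x).le_opNorm _).trans
          (mul_le_mul (hK x hx) (ih x hx) (norm_nonneg _) hK0)) hc hw
      rw [hT0 _ (gd n), sub_zero] at this
      refine this.trans ?_
      have hw' : ‖w - c‖ ≤ r := (mem_ball_iff_norm.1 hw).le
      calc K * (‖v‖ * (1 / 2) ^ n) * ‖w - c‖ ≤ K * (‖v‖ * (1 / 2) ^ n) * r := by gcongr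
        _ = (K * r) * (‖v‖ * (1 / 2) ^ n) := by ring
        _ ≤ 1 / 2 * (‖v‖ * (1 / 2) ^ n) := by gcongr
        _ = _ := by ring
  have hu : Summable fun n : ℕ => ‖v‖ * (1 / 2 : ℝ) ^ n :=
    (summable_geometric_of_lt_one (by norm_num) (by norm_num)).mul_left _
  refine ⟨fun w => ∑' n, g n w, ?_, fun w hw => ?_⟩
  · change ∑' n, g n c = v
    rw [tsum_eq_single 0]
    · simp [hg]
    · intro n hn
      obtain ⟨m, rfl⟩ := Nat.exists_eq_succ_of_ne_zero hn
      rw [Nat.succ_eq_add_one, gs, hT0 _ (gd m)]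
  · have hd := Complex.differentiableOn_tsum_of_summable_norm hu gd isOpen_ball gb
    have hs := Complex.hasSum_deriv_of_summable_norm hu gd isOpen_ball gb hw
    have hda := (hd.differentiableAt (isOpen_ball.mem_nhds hw)).hasDerivAt
    have hsum : Summable fun n => g n w :=
      Summable.of_norm_bounded hu fun n => gb n w hw
    have key : deriv (fun w => ∑' n, g n w) w = M w (∑' n, g n w) := by
      rw [(M w).map_tsum hsum, ← hs.tsum_eq, hs.summable.tsum_eq_zero_add]
      have h0 : deriv (g 0) w = 0 := by simp [hg]
      rw [h0, zero_add]
      exact tsum_congr fun n => by rw [gs]; exact (hT _ (gd n) w hw).deriv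
    rw [key] at hda
    exact hda

theorem SolvesAt.sub {M : ℂ → V →L[ℂ] V} {Y Z : ℂ → V} {z : ℂ} (hY : SolvesAt M Y z)
    (hZ : SolvesAt M Z z) : SolvesAt M (Y - Z) z := by
  unfold SolvesAt at *
  simpa using HasDerivAt.sub hY hZ

/-- Uniqueness, by Grönwall's inequality along the segments of the disc. -/
theorem eqOn_ball_of_solvesAt {M : ℂ → V →L[ℂ] V} {c : ℂ} {r : ℝ}
    (hM : ContinuousOn M (ball c r)) {Y Z : ℂ → V} (hY : ∀ w ∈ ball c r, SolvesAt M Y w)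
    (hZ : ∀ w ∈ ball c r, SolvesAt M Z w) {z : ℂ} (hz : z ∈ ball c r) (h : Y z = Z z) :
    Set.EqOn Y Z (ball c r) := by
  intro w hw
  have seg : ∀ t ∈ Set.Icc (0 : ℝ) 1, z + t * (w - z) ∈ ball c r := by
    intro t ht
    have := (convex_ball c r).add_smul_sub_mem hz hw ht
    simpa using this
  have hline : ∀ t : ℝ, HasDerivAt (fun t : ℝ => z + t * (w - z)) (w - z) t := by
    intro t
    simpa using ((Complex.ofRealCLM.hasDerivAt (x := t)).mul_const (w - z)).const_add z
  have hlc : Continuous fun t : ℝ => z + t * (w - z) := by fun_prop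
  have hD : ∀ t ∈ Set.Icc (0 : ℝ) 1, HasDerivAt (fun t : ℝ => (Y - Z) (z + t * (w - z)))
      ((w - z) • M (z + t * (w - z)) ((Y - Z) (z + t * (w - z)))) t := fun t ht =>
    HasDerivAt.scomp t ((hY _ (seg t ht)).sub (hZ _ (seg t ht))) (hline t)
  have hcont : ContinuousOn (fun t : ℝ => ‖M (z + t * (w - z))‖) (Set.Icc 0 1) :=
    (hM.comp hlc.continuousOn seg).norm
  obtain ⟨K, hK⟩ := isCompact_Icc.bddAbove_image hcont
  have := eq_zero_of_abs_deriv_le_mul_abs_self_of_eq_zero_right (K := ‖w - z‖ * K)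
    (fun t ht => (hD t ht).continuousAt.continuousWithinAt)
    (fun t ht => (hD t (Set.Ico_subset_Icc_self ht)).hasDerivWithinAt)
    (by simp [h]) (fun t ht => by
      rw [norm_smul, mul_assoc]
      refine mul_le_mul_of_nonneg_left (((M _).le_opNorm _).trans ?_) (norm_nonneg _)
      exact mul_le_mul_of_nonneg_right
        (hK (Set.mem_image_of_mem _ (Set.Ico_subset_Icc_self ht))) (norm_nonneg _)) 1
    (by simp)
  simpa [sub_eq_zero] using this

/-- Around every point there is a disc on which the equation can be solved with an arbitrary
value at an arbitrary point of the disc. -/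
theorem exists_ball_forall_solvesAt [CompleteSpace V] {M : ℂ → V →L[ℂ] V} {X : Set ℂ}
    (hX : IsOpen X) (hM : DifferentiableOn ℂ M X) {c : ℂ} (hc : c ∈ X) :
    ∃ r > 0, ball c r ⊆ X ∧ ∀ z ∈ ball c r, ∀ v,
      ∃ Y : ℂ → V, Y z = v ∧ ∀ w ∈ ball c r, SolvesAt M Y w := by
  have hcont : ContinuousAt M c := (hM.differentiableAt (hX.mem_nhds hc)).continuousAt
  have h1 : ∀ᶠ z in 𝓝 c, ‖M z‖ < ‖M c‖ + 1 :=
    hcont.norm.eventually_lt continuousAt_const (by linarith)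
  obtain ⟨R, hR, hRX⟩ := Metric.eventually_nhds_iff_ball.1 (h1.and (hX.mem_nhds hc))
  set K := ‖M c‖ + 1
  have hK : 0 < K := by positivity
  set s := min (R / 2) (1 / (2 * K)) with hs
  have hs0 : 0 < s := by positivity
  have hsR : s ≤ R / 2 := min_le_left _ _
  refine ⟨s / 2, by positivity, fun z hz => (hRX z (ball_subset_ball (by linarith) hz)).2,
    fun z hz v => ?_⟩
  have hsub : ball z s ⊆ ball c R := by
    refine ball_subset_ball' ?_
    have := mem_ball.1 hz
    linarith
  obtain ⟨Y, hYz, hY⟩ := exists_solvesAt_ball (K := K) hs0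
    (hM.mono fun w hw => (hRX w (hsub hw)).2)
    (fun w hw => (hRX w (hsub hw)).1.le) (by
      calc K * s ≤ K * (1 / (2 * K)) := by gcongr; exact min_le_right _ _
        _ = 1 / 2 := by field_simp) v
  refine ⟨Y, hYz, fun w hw => hY w ?_⟩
  have h1 := mem_ball.1 hz
  have h2 := mem_ball.1 hw
  rw [mem_ball]
  have := dist_triangle_right w z c
  linarith

/-- `σ` is a horizontal section along `h` of the local system of solutions of `Y' = M Y`:
locally, it consists of the values along `h` of one solution. -/
def FlatAlong {T : Type*} [TopologicalSpace T] (M : ℂ → V →L[ℂ] V) (h : T → ℂ) (σ : T → V) :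
    Prop :=
  ∀ t₀, ∃ Y : ℂ → V, (∀ᶠ z in 𝓝 (h t₀), SolvesAt M Y z) ∧ ∀ᶠ t in 𝓝 t₀, σ t = Y (h t)

theorem FlatAlong.comp {T S : Type*} [TopologicalSpace T] [TopologicalSpace S]
    {M : ℂ → V →L[ℂ] V} {h : T → ℂ} {σ : T → V} (hσ : FlatAlong M h σ) {f : S → T}
    (hf : Continuous f) : FlatAlong M (h ∘ f) (σ ∘ f) := fun s₀ =>
  let ⟨Y, hY, hY'⟩ := hσ (f s₀)
  ⟨Y, hY, hf.continuousAt.eventually hY'⟩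

/-- Two solutions near `c` that agree at one point close to `c` agree near `c`. -/
theorem eventually_eq_iff_of_solvesAt {M : ℂ → V →L[ℂ] V} {X : Set ℂ} (hX : IsOpen X)
    (hM : ContinuousOn M X) {c : ℂ} (hc : c ∈ X) {Y Z : ℂ → V}
    (hY : ∀ᶠ z in 𝓝 c, SolvesAt M Y z) (hZ : ∀ᶠ z in 𝓝 c, SolvesAt M Z z) :
    ∀ᶠ z in 𝓝 c, (Y z = Z z ↔ Y c = Z c) ∧ (Y z = Z z → Y =ᶠ[𝓝 z] Z) := by
  obtain ⟨r, hr, H⟩ := Metric.eventually_nhds_iff_ball.1 ((hY.and hZ).and (hX.mem_nhds hc))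
  have key : ∀ z ∈ ball c r, Y z = Z z → Set.EqOn Y Z (ball c r) := fun z hz h =>
    eqOn_ball_of_solvesAt (hM.mono fun w hw => (H w hw).2) (fun w hw => (H w hw).1.1)
      (fun w hw => (H w hw).1.2) hz h
  filter_upwards [ball_mem_nhds c hr] with z hz
  exact ⟨⟨fun h => key z hz h (mem_ball_self hr), fun h => key c (mem_ball_self hr) h hz⟩,
    fun h => (key z hz h).eventuallyEq_of_mem (isOpen_ball.mem_nhds hz)⟩

theorem FlatAlong.eq {T : Type*} [TopologicalSpace T] [PreconnectedSpace T]
    {M : ℂ → V →L[ℂ] V} {X : Set ℂ} (hX : IsOpen X) (hM : ContinuousOn M X) {h : T → ℂ}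
    (hh : Continuous h) (hhX : ∀ t, h t ∈ X) {σ τ : T → V} (hσ : FlatAlong M h σ)
    (hτ : FlatAlong M h τ) {t₀ : T} (h₀ : σ t₀ = τ t₀) : σ = τ := by
  have key : ∀ t, ∀ᶠ s in 𝓝 t, (σ s = τ s ↔ σ t = τ t) := by
    intro t
    obtain ⟨Y, hY, hσY⟩ := hσ t
    obtain ⟨Z, hZ, hτZ⟩ := hτ t
    filter_upwards [hσY, hτZ, hh.continuousAt.eventually
      (eventually_eq_iff_of_solvesAt hX hM (hhX t) hY hZ)] with s h1 h2 h3
    rw [h1, h2, hσY.self_of_nhds, hτZ.self_of_nhds, h3.1]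
  have hclopen : IsClopen {t | σ t = τ t} := by
    refine ⟨isOpen_compl_iff.1 (isOpen_iff_mem_nhds.2 fun t ht => ?_),
      isOpen_iff_mem_nhds.2 fun t ht => ?_⟩
    · filter_upwards [key t] with s hs using fun h => ht (hs.1 h)
    · filter_upwards [key t] with s hs using hs.2 ht
  have := hclopen.eq_univ ⟨t₀, h₀⟩
  funext t
  exact this.ge (Set.mem_univ t)

/-- A copy of `V` with the discrete topology, the fibre of the covering of germs of solutions: a
germ at a point is given by its value there, but germs with different values are on different
sheets. -/
structure DiscreteFiber (V : Type*) where
  /-- The underlying vector. -/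
  val : V

instance (V : Type*) : TopologicalSpace (DiscreteFiber V) := ⊥

instance (V : Type*) : DiscreteTopology (DiscreteFiber V) := ⟨rfl⟩

/-- Analytic continuation of solutions along maps from simply connected spaces: the germs of
solutions form a covering space of `X`, and maps from simply connected spaces lift to it. -/
theorem exists_flatAlong [CompleteSpace V] {T : Type*} [TopologicalSpace T]
    [SimplyConnectedSpace T] [LocallyPathConnectedSpace T] {M : ℂ → V →L[ℂ] V} {X : Set ℂ}
    (hX : IsOpen X) (hM : DifferentiableOn ℂ M X) {h : T → ℂ} (hh : Continuous h)
    (hhX : ∀ t, h t ∈ X) (t₀ : T) (v : V) :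
    ∃ σ : T → V, FlatAlong M h σ ∧ σ t₀ = v := by
  choose! r hr hrX hsol using fun c (hc : c ∈ X) => exists_ball_forall_solvesAt hX hM hc
  choose! sol hsol0 hsol using hsol
  -- `sol c z v` is the solution on the disc around `c` with the value `v` at `z`
  have hself : ∀ x : X, (x : ℂ) ∈ ball (x : ℂ) (r x) := fun x => mem_ball_self (hr x x.2)
  have huniq : ∀ (x : X) (Y Z : ℂ → V), (∀ w ∈ ball (x : ℂ) (r x), SolvesAt M Y w) →
      (∀ w ∈ ball (x : ℂ) (r x), SolvesAt M Z w) → ∀ z ∈ ball (x : ℂ) (r x), Y z = Z z →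
      Set.EqOn Y Z (ball x (r x)) := fun x Y Z hY hZ z hz h =>
    eqOn_ball_of_solvesAt (hM.continuousOn.mono (hrX x x.2)) hY hZ hz h
  -- The sheets over the disc around `i` are numbered by the values of the solutions at `i`; to pass
  -- from `i` to `j` at `x`, the solution is evaluated at `x` and continued on the disc around `j`.
  let C : FiberBundleCore X X (DiscreteFiber V) :=
    { baseSet := fun i => Subtype.val ⁻¹' ball (i : ℂ) (r i)
      isOpen_baseSet := fun i => isOpen_ball.preimage continuous_subtype_val
      indexAt := id
      mem_baseSet_at := hself
      coordChange := fun i j x v => ⟨sol j x (sol i i v.val x) j⟩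
      coordChange_self := by
        intro i x hx ⟨v⟩
        have := huniq i (sol i x (sol i i v x)) (sol i i v) (hsol i i.2 x hx _)
          (hsol i i.2 i (hself i) v) x hx (hsol0 i i.2 x hx _) (hself i)
        simp only [this, hsol0 i i.2 i (hself i)]
      continuousOn_coordChange := by
        rintro i j ⟨x₀, ⟨v₀⟩⟩ ⟨⟨hi, hj⟩, -⟩
        refine ContinuousAt.continuousWithinAt ?_
        refine ContinuousAt.congr (f := fun _ => ⟨sol j x₀ (sol i i v₀ x₀) j⟩)
          continuousAt_const ?_
        have h1 : ∀ᶠ z in 𝓝 (x₀ : ℂ), sol j x₀ (sol i i v₀ x₀) z = sol i i v₀ z := by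
          have := eventually_eq_iff_of_solvesAt hX hM.continuousOn x₀.2
            (Y := sol j x₀ (sol i i v₀ x₀)) (Z := sol i i v₀)
            (Filter.mem_of_superset (isOpen_ball.mem_nhds hj) (hsol j j.2 x₀ hj _))
            (Filter.mem_of_superset (isOpen_ball.mem_nhds hi) (hsol i i.2 i (hself i) _))
          filter_upwards [this] with z hz
          exact hz.1.2 (hsol0 j j.2 x₀ hj _)
        have h2 : ∀ᶠ x : X in 𝓝 x₀, (x : ℂ) ∈ ball (j : ℂ) (r j) ∧
            sol j x₀ (sol i i v₀ x₀) x = sol i i v₀ x :=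
          continuous_subtype_val.continuousAt.eventually
            (Filter.Eventually.and (isOpen_ball.mem_nhds hj) h1)
        have h3 : ∀ᶠ p : X × DiscreteFiber V in 𝓝 (x₀, ⟨v₀⟩), p.2 = ⟨v₀⟩ :=
          continuous_snd.continuousAt.eventually
            ((isOpen_discrete {(⟨v₀⟩ : DiscreteFiber V)}).mem_nhds (Set.mem_singleton _))
        filter_upwards [continuous_fst.continuousAt.eventually h2, h3] with p hp hp'
        rw [hp', DiscreteFiber.mk.injEq]
        refine huniq j _ _ (hsol j j.2 x₀ hj _) (hsol j j.2 p.1 hp.1 _) p.1 hp.1 ?_ (hself j)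
        rw [hp.2, hsol0 j j.2 p.1 hp.1]
      coordChange_comp := by
        rintro i j k x ⟨⟨hi, hj⟩, hk⟩ ⟨v⟩
        have := huniq j (sol j j (sol j x (sol i i v x) j)) (sol j x (sol i i v x))
          (hsol j j.2 j (hself j) _) (hsol j j.2 x hj _) j (hself j)
          (hsol0 j j.2 j (hself j) _) hj
        simp only [this, hsol0 j j.2 x hj] }
  have cov : IsCoveringMap
      (Bundle.TotalSpace.proj : Bundle.TotalSpace (DiscreteFiber V) C.Fiber → X) :=
    FiberBundle.isCoveringMap
  obtain ⟨F, ⟨hF0, hF⟩, -⟩ := cov.existsUnique_continuousMap_lifts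
    (⟨fun t => ⟨h t, hhX t⟩, by fun_prop⟩ : C(T, X)) t₀ ⟨⟨h t₀, hhX t₀⟩, ⟨v⟩⟩ rfl
  obtain ⟨σ, hσ⟩ : ∃ σ : T → V, ∀ t, F t = ⟨⟨h t, hhX t⟩, ⟨σ t⟩⟩ := by
    refine ⟨fun t => DiscreteFiber.val (F t).2, fun t => ?_⟩
    have : (F t).1 = ⟨h t, hhX t⟩ := congrFun hF t
    rw [← this]
    rfl
  have e : ∀ (i : X) t, C.localTriv i (F t) = (⟨h t, hhX t⟩, ⟨sol i (h t) (σ t) i⟩) := by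
    intro i t
    rw [C.localTriv_apply, hσ]
    refine Prod.ext rfl (congrArg DiscreteFiber.mk ?_)
    exact congrArg (fun v => sol i (h t) v i)
      (hsol0 _ (hhX t) _ (hself ⟨h t, hhX t⟩) (σ t))
  refine ⟨σ, fun t₁ => ?_, ?_⟩
  swap
  · rw [hσ] at hF0
    exact congrArg (fun p : Bundle.TotalSpace (DiscreteFiber V) C.Fiber =>
      DiscreteFiber.val p.2) hF0
  set i : X := ⟨h t₁, hhX t₁⟩ with hi
  refine ⟨sol i i (σ t₁), Filter.mem_of_superset (ball_mem_nhds _ (hr i i.2))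
    (hsol i i.2 i (hself i) _), ?_⟩
  have hsrc : F t₁ ∈ (C.localTriv i).source := by
    rw [C.mem_localTriv_source, ← C.baseSet_at, hσ]
    exact hself i
  have h1 : ContinuousAt (fun t => C.localTriv i (F t)) t₁ :=
    ContinuousAt.comp ((C.localTriv i).continuousAt hsrc) F.continuous.continuousAt
  have h2 : ∀ᶠ t in 𝓝 t₁, (C.localTriv i (F t)).2 = (C.localTriv i (F t₁)).2 :=
    (continuous_snd.continuousAt.comp h1).eventually
      ((isOpen_discrete {(C.localTriv i (F t₁)).2}).mem_nhds (Set.mem_singleton _))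
  have h3 : ∀ᶠ t in 𝓝 t₁, h t ∈ ball (h t₁) (r (h t₁)) :=
    hh.continuousAt.eventually (ball_mem_nhds _ (hr _ (hhX t₁)))
  filter_upwards [h2, h3] with t ht ht'
  rw [e, e, DiscreteFiber.mk.injEq, hsol0 i i.2 (h t₁) (hself i)] at ht
  have := huniq i (sol i (h t) (σ t))
    (sol i i (σ t₁)) (hsol i i.2 _ ht' _)
    (hsol i i.2 i (hself i) _) i (hself i) (by rw [ht, hsol0 i i.2 i (hself i)]) ht'
  rw [← this, hsol0 i i.2 _ ht']

end LinearODE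

/-! ### Power series on the unit disc -/

section PowerSum

/-- The sum of the power series with coefficients `c`. -/
noncomputable def powerSum (c : ℕ → ℂ) (w : ℂ) : ℂ := ∑' j, c j * w ^ j

/-- The power series with coefficients `c` converges absolutely on the open unit disc. -/
def ConvergesOnDisc (c : ℕ → ℂ) : Prop :=
  ∀ r : ℝ, 0 ≤ r → r < 1 → Summable fun j => ‖c j‖ * r ^ j

variable {c : ℕ → ℂ} {w : ℂ}

theorem ConvergesOnDisc.summable (hc : ConvergesOnDisc c) (hw : ‖w‖ < 1) :
    Summable fun j => c j * w ^ j :=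
  Summable.of_norm (by simpa using hc ‖w‖ (norm_nonneg w) hw)

theorem ConvergesOnDisc.affine_mul (hc : ConvergesOnDisc c) (a b : ℂ) :
    ConvergesOnDisc fun j => (a + b * j) * c j := by
  intro r hr0 hr1
  obtain ⟨s, hs, hs1⟩ := exists_between hr1
  have hs0 : 0 < s := hr0.trans_lt hs
  have hq : r / s < 1 := (div_lt_one hs0).2 hs
  have hq0 : 0 ≤ r / s := by positivity
  have ht : Tendsto (fun j : ℕ => ‖a‖ * (r / s) ^ j + ‖b‖ * (j * (r / s) ^ j)) atTop
      (𝓝 (‖a‖ * 0 + ‖b‖ * 0)) :=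
    ((tendsto_pow_atTop_nhds_zero_of_lt_one hq0 hq).const_mul _).add
      ((tendsto_self_mul_const_pow_of_lt_one hq0 hq).const_mul _)
  obtain ⟨C, hC⟩ := ht.bddAbove_range
  refine Summable.of_nonneg_of_le (fun j => by positivity) (fun j => ?_)
    ((hc s hs0.le hs1).mul_left C)
  have h1 : ‖a + b * j‖ ≤ ‖a‖ + ‖b‖ * j := (norm_add_le _ _).trans (by simp)
  have h2 : r ^ j = (r / s) ^ j * s ^ j := by rw [← mul_pow, div_mul_cancel₀ _ hs0.ne']
  calc ‖(a + b * j) * c j‖ * r ^ j ≤ (‖a‖ + ‖b‖ * j) * ‖c j‖ * r ^ j := by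
        rw [norm_mul]; gcongr
    _ = (‖a‖ * (r / s) ^ j + ‖b‖ * (j * (r / s) ^ j)) * (‖c j‖ * s ^ j) := by rw [h2]; ring
    _ ≤ C * (‖c j‖ * s ^ j) := by gcongr; exact hC ⟨j, rfl⟩

theorem ConvergesOnDisc.affine_pow_mul (hc : ConvergesOnDisc c) (a b : ℂ) (m : ℕ) :
    ConvergesOnDisc fun j => (a + b * j) ^ m * c j := by
  induction m with
  | zero => simpa using hc
  | succ m ih => simpa only [pow_succ', mul_assoc] using ih.affine_mul a b

theorem powerSum_const_mul (a : ℂ) : powerSum (fun j => a * c j) w = a * powerSum c w := by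
  simp only [powerSum, mul_assoc, tsum_mul_left]

theorem powerSum_eq_add (hc : ConvergesOnDisc c) (hw : ‖w‖ < 1) :
    powerSum c w = c 0 + w * powerSum (fun j => c (j + 1)) w := by
  rw [powerSum, (hc.summable hw).tsum_eq_zero_add, powerSum, ← tsum_mul_left]
  simp only [pow_zero, mul_one, pow_succ']
  congr 1
  exact tsum_congr fun j => by ring

theorem powerSum_zero : powerSum c 0 = c 0 := by
  rw [powerSum, tsum_eq_single 0 (fun j hj => by simp [hj])]
  simp

theorem hasDerivAt_powerSum (hc : ConvergesOnDisc c) (hw : ‖w‖ < 1) :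
    HasDerivAt (powerSum c) (powerSum (fun j => (j + 1) * c (j + 1)) w) w := by
  obtain ⟨r, hr, hr1⟩ := exists_between hw
  have hr0 : 0 ≤ r := (norm_nonneg w).trans hr.le
  have hU : IsOpen (Metric.ball (0 : ℂ) r) := Metric.isOpen_ball
  have hwU : w ∈ Metric.ball (0 : ℂ) r := by simpa using hr
  have hd : ∀ j : ℕ, DifferentiableOn ℂ (fun z : ℂ => c j * z ^ j) (Metric.ball 0 r) :=
    fun j => by fun_prop
  have hb : ∀ (j : ℕ) (z : ℂ), z ∈ Metric.ball (0 : ℂ) r → ‖c j * z ^ j‖ ≤ ‖c j‖ * r ^ j := by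
    intro j z hz
    rw [norm_mul, norm_pow]
    have : ‖z‖ ≤ r := by simpa using (mem_ball_zero_iff.1 hz).le
    gcongr
  have h1 := Complex.differentiableOn_tsum_of_summable_norm (hc r hr0 hr1) hd hU hb
  have h2 := Complex.hasSum_deriv_of_summable_norm (hc r hr0 hr1) hd hU hb hwU
  have h3 := (h1.differentiableAt (hU.mem_nhds hwU)).hasDerivAt
  convert! h3 using 1
  rw [← h2.tsum_eq, h2.summable.tsum_eq_zero_add, powerSum]
  simp only [pow_zero, mul_one, deriv_const, zero_add]
  refine tsum_congr fun j => ?_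
  simp
  ring

/-- The Euler operator `w d/dw` multiplies the `j`-th coefficient by `j`. -/
theorem mul_powerSum_deriv (hc : ConvergesOnDisc c) (hw : ‖w‖ < 1) :
    w * powerSum (fun j => (j + 1) * c (j + 1)) w = powerSum (fun j => j * c j) w := by
  have := powerSum_eq_add (by simpa using hc.affine_mul 0 1) hw
  simpa using this.symm

/-- A polynomial in an operator that multiplies the `j`-th coefficient by `x j` multiplies it by the
value of the polynomial at `x j`. -/
theorem powerSum_poly (x : ℕ → ℂ) (hx : ∀ m : ℕ, ConvergesOnDisc fun j => x j ^ m * c j)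
    (P : Polynomial ℂ) {N : ℕ} (hN : P.natDegree < N) (hw : ‖w‖ < 1) :
    ∑ m ∈ Finset.range N, P.coeff m * powerSum (fun j => x j ^ m * c j) w =
      powerSum (fun j => P.eval (x j) * c j) w := by
  simp only [powerSum, ← tsum_mul_left]
  rw [← Summable.tsum_finsetSum fun m _ => ((hx m).summable hw).mul_left _]
  refine tsum_congr fun j => ?_
  rw [P.eval_eq_sum_range' hN, Finset.sum_mul, Finset.sum_mul]
  exact Finset.sum_congr rfl fun m _ => by ring

theorem ConvergesOnDisc.poly_mul (x : ℕ → ℂ) (hx : ∀ m : ℕ, ConvergesOnDisc fun j => x j ^ m * c j)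
    (P : Polynomial ℂ) : ConvergesOnDisc fun j => P.eval (x j) * c j := by
  intro r h0 h1
  refine Summable.of_nonneg_of_le (fun j => by positivity) (fun j => ?_)
    (summable_sum (s := Finset.range (P.natDegree + 1))
      fun m _ => ((hx m) r h0 h1).mul_left ‖P.coeff m‖)
  beta_reduce
  rw [P.eval_eq_sum_range, Finset.sum_mul]
  refine (mul_le_mul_of_nonneg_right (norm_sum_le _ _) (by positivity)).trans (le_of_eq ?_)
  rw [Finset.sum_mul]
  exact Finset.sum_congr rfl fun m _ => by rw [mul_assoc, norm_mul, mul_assoc]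

end PowerSum

/-! ### The hypergeometric series -/

section Coeff

variable {p q : ℕ}

/-- The coefficients `∏ (A_i)_n / (∏ (B_j)_n n!)` of the hypergeometric series. -/
noncomputable def hypCoeff (A : Fin p → ℂ) (B : Fin q → ℂ) (n : ℕ) : ℂ :=
  (∏ i, (ascPochhammer ℂ n).eval (A i)) / ((∏ j, (ascPochhammer ℂ n).eval (B j)) * n.factorial)

theorem ascPochhammer_eval_ne_zero {b : ℂ} (hb : ∀ m : ℕ, b ≠ -m) (n : ℕ) :
    (ascPochhammer ℂ n).eval b ≠ 0 := by
  rw [Ne, ascPochhammer_eval_eq_zero_iff]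
  rintro ⟨k, -, hk⟩
  exact hb k (by rw [hk, neg_neg])

theorem hypCoeff_zero (A : Fin p → ℂ) (B : Fin q → ℂ) : hypCoeff A B 0 = 1 := by
  simp [hypCoeff]

/-- The recursion that makes the series a solution of the hypergeometric equation. -/
theorem hypCoeff_succ (A : Fin p → ℂ) {B : Fin q → ℂ} (hB : ∀ j, ∀ m : ℕ, B j ≠ -m) (n : ℕ) :
    ((n + 1) * ∏ j, (B j + n)) * hypCoeff A B (n + 1) = (∏ i, (A i + n)) * hypCoeff A B n := by
  have h1 : ∏ j, (ascPochhammer ℂ n).eval (B j) ≠ 0 :=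
    Finset.prod_ne_zero_iff.2 fun j _ => ascPochhammer_eval_ne_zero (hB j) n
  have h2 : ∏ j, (B j + (n : ℂ)) ≠ 0 :=
    Finset.prod_ne_zero_iff.2 fun j _ h => hB j n (eq_neg_of_add_eq_zero_left h)
  have h3 : (n.factorial : ℂ) ≠ 0 := by exact_mod_cast n.factorial_ne_zero
  have h4 : (n + 1 : ℂ) ≠ 0 := by exact_mod_cast n.succ_ne_zero
  simp only [hypCoeff, ascPochhammer_succ_eval, Finset.prod_mul_distrib, Nat.factorial_succ]
  push_cast
  field_simp

theorem hypCoeff_eq_mul_regularized (A : Fin p → ℂ) {B : Fin q → ℂ}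
    (hB : ∀ j, ∀ m : ℕ, B j ≠ -m) (n : ℕ) :
    hypCoeff A B n = (∏ j, Complex.Gamma (B j)) * Complex.regularizedHGFunCoeff
      (Finset.univ.val.map A) (Finset.univ.val.map B) n := by
  simp only [Complex.regularizedHGFunCoeff, Multiset.map_map]
  change _ = _ * ((∏ i, (ascPochhammer ℂ n).eval (A i)) / (_ * ∏ j, Complex.Gamma (B j + n)))
  have h : ∏ j, Complex.Gamma (B j + n) =
      (∏ j, (ascPochhammer ℂ n).eval (B j)) * ∏ j, Complex.Gamma (B j) := by
    rw [← Finset.prod_mul_distrib]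
    refine Finset.prod_congr rfl fun j _ => ?_
    rw [← Complex.Gamma_add_nat_div_Gamma_eq (B j) (hB j),
      div_mul_cancel₀ _ (Complex.Gamma_ne_zero (hB j))]
  have h1 : ∏ j, Complex.Gamma (B j) ≠ 0 :=
    Finset.prod_ne_zero_iff.2 fun j _ => Complex.Gamma_ne_zero (hB j)
  rw [h, hypCoeff]
  field_simp

theorem genHyp_eq_powerSum (A : Fin p → ℂ) {B : Fin q → ℂ} (hB : ∀ j, ∀ m : ℕ, B j ≠ -m)
    (w : ℂ) : genHyp A B w = powerSum (hypCoeff A B) w := by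
  rw [genHyp, Complex.regularizedHGFun, Complex.regularizedHGFunSeries,
    ← FormalMultilinearSeries.ofScalarsSum, FormalMultilinearSeries.ofScalarsSum_eq_tsum,
    ← tsum_mul_left, powerSum]
  refine tsum_congr fun n => ?_
  rw [hypCoeff_eq_mul_regularized A hB, smul_eq_mul, mul_assoc]

theorem convergesOnDisc_hypCoeff (A : Fin (q + 1) → ℂ) {B : Fin q → ℂ}
    (hB : ∀ j, ∀ m : ℕ, B j ≠ -m) : ConvergesOnDisc (hypCoeff A B) := by
  intro r h0 h1
  have hrad := Complex.radius_regularizedHGFunSeries_ge_one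
    (a := Finset.univ.val.map A) (b := Finset.univ.val.map B) (by simp)
  lift r to NNReal using h0
  have hr : (r : ENNReal) < (Complex.regularizedHGFunSeries (Finset.univ.val.map A)
      (Finset.univ.val.map B)).radius :=
    lt_of_lt_of_le (by exact_mod_cast h1) hrad
  have := (FormalMultilinearSeries.summable_norm_mul_pow _ hr).mul_left
    ‖∏ j, Complex.Gamma (B j)‖
  refine this.congr fun n => ?_
  rw [hypCoeff_eq_mul_regularized A hB, norm_mul, Complex.regularizedHGFunSeries,
    FormalMultilinearSeries.ofScalars_norm, mul_assoc]

end Coeff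

/-! ### The hypergeometric differential equation -/

section System

open Polynomial

/-- The shift `(v₀, …, v_q) ↦ (v₁, …, v_q, 0)`. -/
noncomputable def shiftMap (q : ℕ) : (Fin (q + 1) → ℂ) →L[ℂ] (Fin (q + 1) → ℂ) :=
  LinearMap.toContinuousLinearMap (Matrix.toLin'
    (Matrix.of fun i j : Fin (q + 1) => if (j : ℕ) = i + 1 then (1 : ℂ) else 0))

/-- The map `v ↦ (0, …, 0, ∑ P_j v_j)`, where the `P_j` are the coefficients of `P`. -/
noncomputable def lastRowMap (q : ℕ) (P : ℂ[X]) : (Fin (q + 1) → ℂ) →L[ℂ] (Fin (q + 1) → ℂ) :=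
  LinearMap.toContinuousLinearMap (Matrix.toLin'
    (Matrix.of fun i j : Fin (q + 1) => if i = Fin.last q then P.coeff j else 0))

/-- The first order system for `(f, θf, …, θ^q f)`, with `θ = y d/dy`, that is equivalent to the
equation `P(θ) f = y Q(θ) f` with monic polynomials `P` and `Q` of degree `q + 1`. -/
noncomputable def hypSystem (q : ℕ) (P Q : ℂ[X]) (y : ℂ) :
    (Fin (q + 1) → ℂ) →L[ℂ] (Fin (q + 1) → ℂ) :=
  y⁻¹ • (shiftMap q + (1 - y)⁻¹ • (y • lastRowMap q Q - lastRowMap q P))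

/-- The complement of the singularities `0` and `1` of the hypergeometric equation. -/
def regularPoints : Set ℂ := {y | y ≠ 0 ∧ y ≠ 1}

theorem isOpen_regularPoints : IsOpen regularPoints :=
  isOpen_ne.inter isOpen_ne

theorem differentiableOn_hypSystem (q : ℕ) (P Q : ℂ[X]) :
    DifferentiableOn ℂ (hypSystem q P Q) regularPoints := by
  intro y hy
  have h1 : (1 - y) ≠ 0 := sub_ne_zero.2 hy.2.symm
  have h0 : y ≠ 0 := hy.1
  unfold hypSystem
  have hi : DifferentiableAt ℂ (fun y : ℂ => (1 - y)⁻¹) y :=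
    ((differentiableAt_const _).sub differentiableAt_id).inv h1
  have hy : DifferentiableAt ℂ (fun y : ℂ => y • lastRowMap q Q - lastRowMap q P) y :=
    (DifferentiableAt.smul_const differentiableAt_id (lastRowMap q Q)).sub_const _
  exact ((differentiableAt_inv h0).smul ((hi.smul hy).const_add _)).differentiableWithinAt

/-- A solution of `P(θ) f = y Q(θ) f`, given with its derivatives `Y m = θ^m f`, solves the
system. -/
theorem solvesAt_jet {q : ℕ} {P Q : ℂ[X]} {y : ℂ} (hy : y ∈ regularPoints) {Y : ℕ → ℂ → ℂ}
    (hY : ∀ m, HasDerivAt (Y m) (y⁻¹ * Y (m + 1) y) y) (hP : P.coeff (q + 1) = 1)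
    (hQ : Q.coeff (q + 1) = 1)
    (hode : ∑ m ∈ Finset.range (q + 2), (P.coeff m - y * Q.coeff m) * Y m y = 0) :
    SolvesAt (hypSystem q P Q) (fun z (m : Fin (q + 1)) => Y m z) y := by
  have h1 : (1 - y) ≠ 0 := sub_ne_zero.2 hy.2.symm
  refine hasDerivAt_pi.2 fun i => ?_
  convert! hY i using 1
  simp only [hypSystem, smul_apply, add_apply, sub_apply, Pi.smul_apply, Pi.add_apply, Pi.sub_apply,
    smul_eq_mul]
  congr 1
  simp only [shiftMap, lastRowMap, LinearMap.coe_toContinuousLinearMap', Matrix.toLin'_apply,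
    Matrix.mulVec, dotProduct, Matrix.of_apply]
  refine Fin.lastCases ?_ (fun i => ?_) i
  · have e0 : ∑ x : Fin (q + 1), (if (x : ℕ) = Fin.last q + 1 then (1 : ℂ) else 0) * Y x y = 0 :=
      Finset.sum_eq_zero fun x _ => by rw [if_neg (by have := x.2; simp; omega), zero_mul]
    rw [Finset.sum_range_succ, hP, hQ] at hode
    simp only [sub_mul, Finset.sum_sub_distrib, mul_assoc, ← Finset.mul_sum] at hode
    rw [e0]
    simp only [if_true, zero_add, Fin.val_last]
    rw [Fin.sum_univ_eq_sum_range (fun m => Q.coeff m * Y m y),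
      Fin.sum_univ_eq_sum_range (fun m => P.coeff m * Y m y)]
    field_simp
    linear_combination -hode
  · rw [Finset.sum_eq_single i.succ]
    · simp [(Fin.castSucc_lt_last i).ne]
    · intro b _ hb
      rw [if_neg, zero_mul]
      intro h
      exact hb (Fin.ext (by simpa using h))
    · simp

end System

section Hypergeometric

open Polynomial

variable {q : ℕ}

/-- The parameters of the theorem: the series is defined and no two of its exponents at `∞`
differ by an integer. -/
structure NonResonant (A : Fin (q + 1) → ℂ) (B : Fin q → ℂ) : Prop where
  lower : ∀ j, ∀ m : ℕ, B j ≠ -m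
  diff : ∀ i j, i ≠ j → ∀ m : ℤ, A i - A j ≠ m

/-- The polynomial `X ∏ (X + B_j - 1)`. -/
noncomputable def lowerPoly (B : Fin q → ℂ) : ℂ[X] := X * ∏ j, (X + C (B j - 1))

/-- The polynomial `∏ (X + A_i)`. -/
noncomputable def upperPoly (A : Fin (q + 1) → ℂ) : ℂ[X] := ∏ i, (X + C (A i))

theorem lowerPoly_monic (B : Fin q → ℂ) : (lowerPoly B).Monic :=
  monic_X.mul (monic_prod_of_monic _ _ fun _ _ => monic_X_add_C _)

theorem upperPoly_monic (A : Fin (q + 1) → ℂ) : (upperPoly A).Monic :=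
  monic_prod_of_monic _ _ fun _ _ => monic_X_add_C _

theorem natDegree_lowerPoly (B : Fin q → ℂ) : (lowerPoly B).natDegree = q + 1 := by
  rw [lowerPoly, monic_X.natDegree_mul (monic_prod_of_monic _ _ fun _ _ => monic_X_add_C _),
    natDegree_prod_of_monic _ _ fun _ _ => monic_X_add_C _]
  simp only [natDegree_X, natDegree_X_add_C, Finset.sum_const, Finset.card_univ, Fintype.card_fin,
    smul_eq_mul, mul_one, add_comm]

theorem natDegree_upperPoly (A : Fin (q + 1) → ℂ) : (upperPoly A).natDegree = q + 1 := by
  rw [upperPoly, natDegree_prod_of_monic _ _ fun _ _ => monic_X_add_C _]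
  simp

theorem lowerPoly_eval (B : Fin q → ℂ) (x : ℂ) :
    (lowerPoly B).eval x = x * ∏ j, (x + (B j - 1)) := by
  simp only [lowerPoly, eval_mul, eval_X, eval_prod, eval_add, eval_C]

theorem upperPoly_eval (A : Fin (q + 1) → ℂ) (x : ℂ) :
    (upperPoly A).eval x = ∏ i, (x + A i) := by
  simp only [upperPoly, eval_prod, eval_add, eval_X, eval_C]

theorem lowerPoly_coeff (B : Fin q → ℂ) : (lowerPoly B).coeff (q + 1) = 1 := by
  simpa [natDegree_lowerPoly] using (lowerPoly_monic B).coeff_natDegree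

theorem upperPoly_coeff (A : Fin (q + 1) → ℂ) : (upperPoly A).coeff (q + 1) = 1 := by
  simpa [natDegree_upperPoly] using (upperPoly_monic A).coeff_natDegree

/-- The system of the hypergeometric equation `θ ∏ (θ + B_j - 1) f = y ∏ (θ + A_i) f`. -/
noncomputable def hypEq (A : Fin (q + 1) → ℂ) (B : Fin q → ℂ) :
    ℂ → (Fin (q + 1) → ℂ) →L[ℂ] (Fin (q + 1) → ℂ) :=
  hypSystem q (lowerPoly B) (upperPoly A)

/-- `θ^m` of the hypergeometric series. -/
noncomputable def zeroJet (A : Fin (q + 1) → ℂ) (B : Fin q → ℂ) (m : ℕ) : ℂ → ℂ :=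
  powerSum fun j => (j : ℂ) ^ m * hypCoeff A B j

theorem convergesOnDisc_zeroJet (A : Fin (q + 1) → ℂ) {B : Fin q → ℂ}
    (hB : ∀ j, ∀ m : ℕ, B j ≠ -m) (m : ℕ) :
    ConvergesOnDisc fun j => (j : ℂ) ^ m * hypCoeff A B j := by
  simpa using (convergesOnDisc_hypCoeff A hB).affine_pow_mul 0 1 m

/-- The recursion of the coefficients, as an identity between power series. -/
theorem mul_powerSum_shift_eq {c d : ℕ → ℂ} (hc : ConvergesOnDisc c) {w : ℂ} (hw : ‖w‖ < 1)
    (h0 : c 0 = 0) (h : ∀ j, c (j + 1) = d j) : powerSum c w = w * powerSum d w := by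
  rw [powerSum_eq_add hc hw, h0, zero_add]
  simp only [h]

theorem hasDerivAt_zeroJet (A : Fin (q + 1) → ℂ) {B : Fin q → ℂ}
    (hB : ∀ j, ∀ m : ℕ, B j ≠ -m) (m : ℕ) {y : ℂ} (h0 : y ≠ 0) (hy : ‖y‖ < 1) :
    HasDerivAt (zeroJet A B m) (y⁻¹ * zeroJet A B (m + 1) y) y := by
  have hc := convergesOnDisc_zeroJet A hB m
  have h := hasDerivAt_powerSum hc hy
  have h2 := mul_powerSum_deriv hc hy
  convert! h using 1
  rw [inv_mul_eq_iff_eq_mul₀ h0, h2, zeroJet]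
  simp only [pow_succ', mul_assoc]

theorem solvesAt_zeroJet (A : Fin (q + 1) → ℂ) {B : Fin q → ℂ}
    (hB : ∀ j, ∀ m : ℕ, B j ≠ -m) {y : ℂ} (h0 : y ≠ 0) (hy : ‖y‖ < 1) :
    SolvesAt (hypEq A B) (fun z (m : Fin (q + 1)) => zeroJet A B m z) y := by
  refine solvesAt_jet ⟨h0, by rintro rfl; simp at hy⟩
    (fun m => hasDerivAt_zeroJet A hB m h0 hy) (lowerPoly_coeff B) (upperPoly_coeff A) ?_
  have hx := convergesOnDisc_zeroJet A hB
  simp only [sub_mul, Finset.sum_sub_distrib, mul_assoc, ← Finset.mul_sum, zeroJet]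
  rw [powerSum_poly _ hx _ (by rw [natDegree_lowerPoly]; omega) hy,
    powerSum_poly _ hx _ (by rw [natDegree_upperPoly]; omega) hy, sub_eq_zero]
  refine mul_powerSum_shift_eq (ConvergesOnDisc.poly_mul _ hx _) hy ?_ fun j => ?_
  · simp [lowerPoly_eval]
  · rw [lowerPoly_eval, upperPoly_eval]
    have := hypCoeff_succ A hB j
    simp only [add_comm (A _)] at this
    rw [← this]
    push_cast
    congr 3
    ext i
    ring

/-- The upper parameters of the hypergeometric series in `1 / y` that belongs to the exponent
`A_k` at infinity. -/
noncomputable def infUpper (A : Fin (q + 1) → ℂ) (B : Fin q → ℂ) (k : Fin (q + 1)) :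
    Fin (q + 1) → ℂ :=
  Fin.cons (A k) fun j => A k - B j + 1

/-- The lower parameters of the hypergeometric series in `1 / y` that belongs to the exponent
`A_k` at infinity. -/
noncomputable def infLower (A : Fin (q + 1) → ℂ) (k : Fin (q + 1)) : Fin q → ℂ :=
  fun i => A k - A (k.succAbove i) + 1

/-- The coefficients of the series at infinity. -/
noncomputable def infCoeff (A : Fin (q + 1) → ℂ) (B : Fin q → ℂ) (k : Fin (q + 1)) : ℕ → ℂ :=
  hypCoeff (infUpper A B k) (infLower A k)

theorem NonResonant.infLower_ne {A : Fin (q + 1) → ℂ} {B : Fin q → ℂ} (h : NonResonant A B)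
    (k : Fin (q + 1)) (i : Fin q) (m : ℕ) : infLower A k i ≠ -m := by
  intro e
  refine h.diff k (k.succAbove i) (Fin.succAbove_ne k i).symm (-m - 1) ?_
  push_cast
  rw [infLower] at e
  linear_combination e

theorem NonResonant.convergesOnDisc_infCoeff {A : Fin (q + 1) → ℂ} {B : Fin q → ℂ}
    (h : NonResonant A B) (k : Fin (q + 1)) : ConvergesOnDisc (infCoeff A B k) :=
  convergesOnDisc_hypCoeff _ (h.infLower_ne k)

/-- `(d/du)^m` of the solution `(-y)^(-A_k) (1 + O(1 / y))`, in the coordinate `u` with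
`y = -e^u`. -/
noncomputable def infJet (A : Fin (q + 1) → ℂ) (B : Fin q → ℂ) (k : Fin (q + 1)) (m : ℕ)
    (u : ℂ) : ℂ :=
  Complex.exp (-A k * u) *
    powerSum (fun j => (-A k + (-1) * j) ^ m * infCoeff A B k j) (-Complex.exp (-u))

theorem norm_neg_exp_neg_lt_one {u : ℂ} (hu : 0 < u.re) : ‖-Complex.exp (-u)‖ < 1 := by
  rw [norm_neg, Complex.norm_exp]
  simpa using hu

theorem hasDerivAt_exp_mul_powerSum {c : ℕ → ℂ} (hc : ConvergesOnDisc c) (a : ℂ) {u : ℂ}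
    (hu : 0 < u.re) :
    HasDerivAt (fun u => Complex.exp (a * u) * powerSum c (-Complex.exp (-u)))
      (Complex.exp (a * u) * powerSum (fun j => (a + (-1) * j) * c j) (-Complex.exp (-u))) u := by
  have hw := norm_neg_exp_neg_lt_one hu
  have h1 : HasDerivAt (fun u => -Complex.exp (-u)) (Complex.exp (-u)) u := by
    simpa using (hasDerivAt_neg' u).cexp.fun_neg
  have h2 := (hasDerivAt_powerSum hc hw).comp u h1
  have h3 : HasDerivAt (fun u => Complex.exp (a * u)) (Complex.exp (a * u) * a) u := by
    simpa using ((hasDerivAt_id u).const_mul a).cexp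
  convert! h3.mul h2 using 1
  have h4 := mul_powerSum_deriv hc hw
  have h5 : powerSum (fun j => (a + (-1) * j) * c j) (-Complex.exp (-u)) =
      a * powerSum c (-Complex.exp (-u)) - powerSum (fun j => j * c j) (-Complex.exp (-u)) := by
    rw [powerSum, powerSum, powerSum, ← tsum_mul_left, ← Summable.tsum_sub]
    · exact tsum_congr fun j => by ring
    · exact (hc.summable hw).mul_left a
    · exact ConvergesOnDisc.summable (by simpa using hc.affine_mul 0 1) hw
  rw [h5, ← h4]
  simp only [Function.comp_apply]
  ring

theorem NonResonant.hasDerivAt_infJet {A : Fin (q + 1) → ℂ} {B : Fin q → ℂ}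
    (h : NonResonant A B) (k : Fin (q + 1)) (m : ℕ) {u : ℂ} (hu : 0 < u.re) :
    HasDerivAt (infJet A B k m) (infJet A B k (m + 1) u) u := by
  have := hasDerivAt_exp_mul_powerSum
    ((h.convergesOnDisc_infCoeff k).affine_pow_mul (-A k) (-1) m) (-A k) hu
  simp only [← mul_assoc, ← pow_succ'] at this
  exact this

theorem prod_eq_neg_one_pow_mul {f g : Fin q → ℂ} (h : ∀ i, f i = -g i) :
    ∏ i, f i = (-1) ^ q * ∏ i, g i := by
  simp only [h, Finset.prod_neg, Finset.card_univ, Fintype.card_fin]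

/-- The recursion for the coefficients of a solution at infinity. The polynomials change places
compared with the recursion at `0`, being evaluated at the exponents `-A_k - j`. -/
theorem NonResonant.infCoeff_succ {A : Fin (q + 1) → ℂ} {B : Fin q → ℂ}
    (h : NonResonant A B) (k : Fin (q + 1)) (j : ℕ) :
    (upperPoly A).eval (-A k + (-1) * (j + 1)) * infCoeff A B k (j + 1) =
      (lowerPoly B).eval (-A k + (-1) * j) * infCoeff A B k j := by
  have := hypCoeff_succ (infUpper A B k) (h.infLower_ne k) j
  rw [Fin.prod_univ_succ] at this
  simp only [infUpper, Fin.cons_zero, Fin.cons_succ] at this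
  rw [upperPoly_eval, lowerPoly_eval, Fin.prod_univ_succAbove _ k]
  have e1 : ∏ i : Fin q, (-A k + (-1) * ((j : ℂ) + 1) + A (k.succAbove i)) =
      (-1) ^ q * ∏ i, (infLower A k i + j) := by
    refine prod_eq_neg_one_pow_mul fun i => ?_
    rw [infLower]
    ring
  have e2 : ∏ i : Fin q, (-A k + (-1) * (j : ℂ) + (B i - 1)) =
      (-1) ^ q * ∏ i, (A k - B i + 1 + j) := by
    exact prod_eq_neg_one_pow_mul fun i => by ring
  rw [e1, e2]
  change _ * infCoeff A B k (j + 1) = _ * infCoeff A B k j at this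
  linear_combination (-(-1 : ℂ) ^ q) * this

/-- The solutions at infinity satisfy the hypergeometric equation, in the coordinate `u`, in which
`θ` is `d/du`. -/
theorem NonResonant.sum_infJet {A : Fin (q + 1) → ℂ} {B : Fin q → ℂ}
    (h : NonResonant A B) (k : Fin (q + 1)) {u : ℂ} (hu : 0 < u.re) :
    ∑ m ∈ Finset.range (q + 2), ((lowerPoly B).coeff m - -Complex.exp u * (upperPoly A).coeff m) *
      infJet A B k m u = 0 := by
  have hw := norm_neg_exp_neg_lt_one hu
  have hx := (h.convergesOnDisc_infCoeff k).affine_pow_mul (-A k) (-1)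
  have e : ∀ m, ((lowerPoly B).coeff m - -Complex.exp u * (upperPoly A).coeff m) *
      infJet A B k m u = Complex.exp (-A k * u) *
        ((lowerPoly B).coeff m * powerSum (fun j => (-A k + (-1) * j) ^ m * infCoeff A B k j)
          (-Complex.exp (-u))) + Complex.exp (-A k * u) * (Complex.exp u *
        ((upperPoly A).coeff m * powerSum (fun j => (-A k + (-1) * j) ^ m * infCoeff A B k j)
          (-Complex.exp (-u)))) := fun m => by rw [infJet]; ring
  simp only [e, Finset.sum_add_distrib, ← Finset.mul_sum]
  rw [powerSum_poly _ hx _ (by rw [natDegree_lowerPoly]; omega) hw,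
    powerSum_poly _ hx _ (by rw [natDegree_upperPoly]; omega) hw]
  have := mul_powerSum_shift_eq (ConvergesOnDisc.poly_mul _ hx (upperPoly A)) hw
    (d := fun j => (lowerPoly B).eval (-A k + (-1) * j) * infCoeff A B k j)
    (by rw [upperPoly_eval, Finset.prod_eq_zero (Finset.mem_univ k)] <;> simp)
    (fun j => by have := h.infCoeff_succ k j; push_cast; exact this)
  rw [this]
  have e' : Complex.exp u * -Complex.exp (-u) = -1 := by
    rw [Complex.exp_neg]; field_simp
  linear_combination (Complex.exp (-A k * u) * powerSum (fun j =>
    (lowerPoly B).eval (-A k + (-1) * j) * infCoeff A B k j) (-Complex.exp (-u))) * e'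

end Hypergeometric

/-! ### The local solutions at `0` and at `∞` -/

section LocalSolutions

variable {q : ℕ} {A : Fin (q + 1) → ℂ} {B : Fin q → ℂ}

theorem FlatAlong.linearCombination {V T ι : Type*} [NormedAddCommGroup V] [NormedSpace ℂ V]
    [TopologicalSpace T] [Fintype ι] {M : ℂ → V →L[ℂ] V} {h : T → ℂ} {σ : ι → T → V}
    (hσ : ∀ i, FlatAlong M h (σ i)) (d : ι → ℂ) :
    FlatAlong M h fun t => ∑ i, d i • σ i t := by
  intro t₀
  choose Y hY hσY using fun i => hσ i t₀
  refine ⟨fun z => ∑ i, d i • Y i z, ?_, ?_⟩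
  · filter_upwards [eventually_all.2 hY] with z hz
    unfold SolvesAt
    simp only [map_sum, map_smul]
    exact HasDerivAt.fun_sum fun i _ => (hz i).const_smul (d i)
  · filter_upwards [eventually_all.2 hσY] with t ht
    simp only [ht]

theorem flatAlong_zeroJet (hB : ∀ j, ∀ m : ℕ, B j ≠ -m) {T : Type*} [TopologicalSpace T]
    {h : T → ℂ} (h0 : ∀ t, h t ≠ 0) (h1 : ∀ t, ‖h t‖ < 1) :
    FlatAlong (hypEq A B) h fun t (m : Fin (q + 1)) => zeroJet A B m (h t) := by
  refine fun t₀ => ⟨fun z (m : Fin (q + 1)) => zeroJet A B m z, ?_, .of_forall fun t => rfl⟩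
  filter_upwards [isOpen_ne.mem_nhds (h0 t₀),
    (isOpen_lt continuous_norm continuous_const).mem_nhds (h1 t₀)] with z hz0 hz1
  exact solvesAt_zeroJet A hB hz0 hz1

/-- A local inverse of `u ↦ -e^u` near an arbitrary point `u₀`. -/
theorem exists_local_log_neg (u₀ : ℂ) : ∃ lg : ℂ → ℂ, lg (-Complex.exp u₀) = u₀ ∧
    (∀ᶠ y in 𝓝 (-Complex.exp u₀), HasDerivAt lg y⁻¹ y ∧ -Complex.exp (lg y) = y) ∧
    ∀ᶠ u in 𝓝 u₀, lg (-Complex.exp u) = u := by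
  have he : Complex.exp u₀ ≠ 0 := Complex.exp_ne_zero _
  refine ⟨fun y => u₀ + Complex.log (-y / Complex.exp u₀), by simp [he], ?_, ?_⟩
  · have hc : ContinuousAt (fun y : ℂ => -y / Complex.exp u₀) (-Complex.exp u₀) := by fun_prop
    have h1 : -(-Complex.exp u₀) / Complex.exp u₀ ∈ Complex.slitPlane := by
      rw [neg_neg, div_self he]
      exact Complex.one_mem_slitPlane
    filter_upwards [hc.eventually (Complex.isOpen_slitPlane.mem_nhds h1)] with y hy
    have hy0 : y ≠ 0 := by
      rintro rfl
      simp at hy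
    constructor
    · have h2 : HasDerivAt (fun y : ℂ => -y / Complex.exp u₀) (-1 / Complex.exp u₀) y :=
        (hasDerivAt_neg' y).div_const _
      convert! (h2.clog hy).const_add u₀ using 1
      field_simp
    · rw [Complex.exp_add, Complex.exp_log (by field_simp; simpa using hy0)]
      field_simp
  · have hc : ContinuousAt (fun u : ℂ => (u - u₀).im) u₀ := by fun_prop
    have h1 : ∀ᶠ u in 𝓝 u₀, (u - u₀).im ∈ Set.Ioo (-Real.pi) Real.pi :=
      hc.eventually (isOpen_Ioo.mem_nhds (by simp [Real.pi_pos]))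
    filter_upwards [h1] with u hu
    rw [neg_neg, ← Complex.exp_sub, Complex.log_exp hu.1 hu.2.le]
    ring

theorem neg_exp_mem_regularPoints {u : ℂ} (hu : u.re ≠ 0) :
    -Complex.exp u ∈ regularPoints := by
  refine ⟨neg_ne_zero.2 (Complex.exp_ne_zero _), fun h => hu ?_⟩
  have : ‖Complex.exp u‖ = 1 := by rw [← norm_neg, h, norm_one]
  rwa [Complex.norm_exp, Real.exp_eq_one_iff] at this

theorem NonResonant.flatAlong_infJet (hAB : NonResonant A B) (k : Fin (q + 1)) {T : Type*}
    [TopologicalSpace T] {ℓ : T → ℂ} (hℓ : Continuous ℓ) (hre : ∀ t, 0 < (ℓ t).re) :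
    FlatAlong (hypEq A B) (fun t => -Complex.exp (ℓ t))
      fun t (m : Fin (q + 1)) => infJet A B k m (ℓ t) := by
  intro t₀
  obtain ⟨lg, hlg0, hlg, hlg'⟩ := exists_local_log_neg (ℓ t₀)
  refine ⟨fun z (m : Fin (q + 1)) => infJet A B k m (lg z), ?_, ?_⟩
  · have hc : ContinuousAt lg (-Complex.exp (ℓ t₀)) := hlg.self_of_nhds.1.continuousAt
    have h1 : ∀ᶠ z in 𝓝 (-Complex.exp (ℓ t₀)), 0 < (lg z).re :=
      (Complex.continuous_re.continuousAt.comp hc).eventually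
        (isOpen_Ioi.mem_nhds (by simpa [hlg0] using hre t₀))
    filter_upwards [hlg, h1] with z hz hz1
    refine solvesAt_jet (Y := fun m z => infJet A B k m (lg z)) ?_ (fun m => ?_)
      (lowerPoly_coeff B) (upperPoly_coeff A) ?_
    · rw [← hz.2]
      exact neg_exp_mem_regularPoints hz1.ne'
    · rw [mul_comm]
      exact (hAB.hasDerivAt_infJet k m hz1).comp z hz.1
    · have := hAB.sum_infJet k hz1
      rwa [hz.2] at this
  · filter_upwards [hℓ.continuousAt.eventually hlg'] with t ht
    simp only [ht]

theorem eqOn_of_eqOn_open {f g : ℂ → ℂ} {W W' : Set ℂ} (hW : IsOpen W) (hWc : IsPreconnected W)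
    (hf : DifferentiableOn ℂ f W) (hg : DifferentiableOn ℂ g W) (hW' : IsOpen W')
    (hne : (W ∩ W').Nonempty) (h : ∀ z ∈ W, z ∈ W' → f z = g z) : Set.EqOn f g W := by
  obtain ⟨z, hz, hz'⟩ := hne
  refine (hf.analyticOnNhd hW).eqOn_of_preconnected_of_eventuallyEq (hg.analyticOnNhd hW) hWc hz ?_
  filter_upwards [hW.mem_nhds hz, hW'.mem_nhds hz'] with w hw hw' using h w hw hw'

/-- The half plane of the coordinate `u` that corresponds to a punctured neighbourhood of `∞`. -/
def rightHalfPlane : Set ℂ := {u | 0 < u.re}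

theorem isOpen_rightHalfPlane : IsOpen rightHalfPlane :=
  isOpen_lt continuous_const Complex.continuous_re

theorem convex_rightHalfPlane : Convex ℝ rightHalfPlane :=
  convex_halfSpace_re_gt 0

theorem NonResonant.differentiableOn_infJet (hAB : NonResonant A B) (k : Fin (q + 1)) (m : ℕ) :
    DifferentiableOn ℂ (infJet A B k m) rightHalfPlane := fun _ hu =>
  (hAB.hasDerivAt_infJet k m hu).differentiableAt.differentiableWithinAt

theorem infCoeff_zero (A : Fin (q + 1) → ℂ) (B : Fin q → ℂ) (k : Fin (q + 1)) :
    infCoeff A B k 0 = 1 := hypCoeff_zero _ _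

theorem infJet_order_zero (A : Fin (q + 1) → ℂ) (B : Fin q → ℂ) (k : Fin (q + 1)) (u : ℂ) :
    infJet A B k 0 u =
      Complex.exp (-A k * u) * powerSum (infCoeff A B k) (-Complex.exp (-u)) := by
  simp only [infJet, pow_zero, one_mul]

theorem NonResonant.tendsto_powerSum_infCoeff (hAB : NonResonant A B) (k : Fin (q + 1)) :
    Tendsto (fun t : ℝ => powerSum (infCoeff A B k) (-Complex.exp (-t))) atTop (𝓝 1) := by
  have h1 : ContinuousAt (powerSum (infCoeff A B k)) 0 :=
    (hasDerivAt_powerSum (hAB.convergesOnDisc_infCoeff k) (by simp)).continuousAt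
  have h2 : Tendsto (fun t : ℝ => -Complex.exp (-t)) atTop (𝓝 0) := by
    rw [tendsto_zero_iff_norm_tendsto_zero]
    simpa [Complex.norm_exp] using Real.tendsto_exp_neg_atTop_nhds_zero
  have h3 := h1.tendsto.comp h2
  rw [powerSum_zero, infCoeff_zero] at h3
  exact h3

/-- The solutions at infinity are linearly independent, because continuation around `∞`, that is,
the translation `u ↦ u + 2πi`, multiplies them by distinct factors. -/
theorem NonResonant.eq_zero_of_sum_infJet_eq_zero (hAB : NonResonant A B) {e : Fin (q + 1) → ℂ}
    (he : ∀ u ∈ rightHalfPlane, ∑ k, e k * infJet A B k 0 u = 0) : e = 0 := by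
  let τ : rightHalfPlane → rightHalfPlane := fun u =>
    ⟨u + 2 * Real.pi * Complex.I, by
      have := u.2
      simp only [rightHalfPlane, Set.mem_ofPred_eq] at this ⊢
      simpa using this⟩
  let f : Module.End ℂ (rightHalfPlane → ℂ) := LinearMap.funLeft ℂ ℂ τ
  let v : Fin (q + 1) → rightHalfPlane → ℂ := fun k u => infJet A B k 0 u
  have hinj : Function.Injective fun k => Complex.exp (-A k * (2 * Real.pi * Complex.I)) := by
    intro i j hij
    by_contra hne
    obtain ⟨n, hn⟩ := Complex.exp_eq_exp_iff_exists_int.1 hij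
    refine hAB.diff i j hne (-n) ?_
    have h0 : 2 * Real.pi * Complex.I ≠ 0 := Complex.two_pi_I_ne_zero
    push_cast
    apply mul_right_cancel₀ h0
    linear_combination -hn
  have hvec : ∀ k, f.HasEigenvector (Complex.exp (-A k * (2 * Real.pi * Complex.I))) (v k) := by
    intro k
    refine ⟨Module.End.mem_eigenspace_iff.2 ?_, fun h0 => ?_⟩
    · funext u
      simp only [f, v, τ, LinearMap.funLeft_apply, Pi.smul_apply, smul_eq_mul, infJet_order_zero]
      have : Complex.exp (-((u : ℂ) + 2 * Real.pi * Complex.I)) = Complex.exp (-(u : ℂ)) := by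
        rw [neg_add, ← sub_eq_add_neg, Complex.exp_sub, Complex.exp_two_pi_mul_I, div_one]
      rw [this, mul_add, Complex.exp_add]
      ring
    · have h1 : ∀ᶠ t : ℝ in atTop, powerSum (infCoeff A B k) (-Complex.exp (-t)) = 0 := by
        filter_upwards [eventually_gt_atTop 0] with t ht
        have := congrFun h0 ⟨(t : ℂ), by simpa [rightHalfPlane] using ht⟩
        simp only [v, infJet_order_zero, Pi.zero_apply, mul_eq_zero] at this
        exact this.resolve_left (Complex.exp_ne_zero _)
      have h2 := (hAB.tendsto_powerSum_infCoeff k).congr' h1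
      exact zero_ne_one (tendsto_nhds_unique tendsto_const_nhds h2)
  have hli := f.eigenvectors_linearIndependent' _ hinj v hvec
  funext k
  refine Fintype.linearIndependent_iff.1 hli e ?_ k
  funext u
  simpa [v] using he u u.2

theorem NonResonant.linearIndependent_infJet (hAB : NonResonant A B) {u₀ : ℂ}
    (hu₀ : u₀ ∈ rightHalfPlane) :
    LinearIndependent ℂ fun k (m : Fin (q + 1)) => infJet A B k m u₀ := by
  refine Fintype.linearIndependent_iff.2 fun e he k => ?_
  refine congrFun (hAB.eq_zero_of_sum_infJet_eq_zero fun u hu => ?_) k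
  have : PreconnectedSpace rightHalfPlane :=
    Subtype.preconnectedSpace convex_rightHalfPlane.isPreconnected
  have hℓ : Continuous (Subtype.val : rightHalfPlane → ℂ) := continuous_subtype_val
  have h1 := FlatAlong.linearCombination
    (fun k => hAB.flatAlong_infJet k hℓ fun u : rightHalfPlane => u.2) e
  have h2 := FlatAlong.linearCombination
    (fun k => hAB.flatAlong_infJet k hℓ fun u : rightHalfPlane => u.2) 0
  have := h1.eq isOpen_regularPoints (differentiableOn_hypSystem _ _ _).continuousOn
    (by fun_prop) (fun u => neg_exp_mem_regularPoints u.2.ne') h2 (t₀ := ⟨u₀, hu₀⟩)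
    (by simpa using he)
  simpa using congrFun (congrFun this ⟨u, hu⟩) 0

/-- As many solutions as the system has unknowns, and independent: they form a basis. -/
theorem NonResonant.exists_eq_sum_infJet (hAB : NonResonant A B) {u₀ : ℂ}
    (hu₀ : u₀ ∈ rightHalfPlane) (v : Fin (q + 1) → ℂ) :
    ∃ d : Fin (q + 1) → ℂ, v = ∑ k, d k • fun m : Fin (q + 1) => infJet A B k m u₀ := by
  have h := (hAB.linearIndependent_infJet hu₀).span_eq_top_of_card_eq_finrank' (by simp)
  have hv : v ∈ Submodule.span ℂ
      (Set.range fun k (m : Fin (q + 1)) => infJet A B k m u₀) := h ▸ Submodule.mem_top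
  obtain ⟨d, hd⟩ := (Submodule.mem_span_range_iff_exists_fun ℂ).1 hv
  exact ⟨d, hd.symm⟩

end LocalSolutions

/-! ### The connection problem on the slit plane -/

section Connection

variable {q : ℕ} {A : Fin (q + 1) → ℂ} {B : Fin q → ℂ}

/-- The strip that `u ↦ -e^u` maps onto the plane without the nonnegative real axis. -/
def strip : Set ℂ := {u | |u.im| < Real.pi}

theorem isOpen_strip : IsOpen strip :=
  isOpen_lt (by fun_prop) continuous_const

theorem strip_eq : strip = {u | -Real.pi < u.im} ∩ {u | u.im < Real.pi} := by
  ext u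
  simp [strip, abs_lt]

theorem convex_strip : Convex ℝ strip := by
  rw [strip_eq]
  exact (convex_halfSpace_im_gt _).inter (convex_halfSpace_im_lt _)

theorem ofReal_mem_strip (t : ℝ) : (t : ℂ) ∈ strip := by
  simp [strip, Real.pi_pos]

theorem one_add_exp_mem_slitPlane {u : ℂ} (hu : u ∈ strip) :
    1 + Complex.exp u ∈ Complex.slitPlane := by
  by_cases h : u.im = 0
  · left
    rw [Complex.add_re, Complex.exp_re, h]
    simp
    positivity
  · right
    rw [Complex.add_im, Complex.exp_im]
    simp only [Complex.one_im, zero_add]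
    refine mul_ne_zero (Real.exp_pos _).ne' fun h0 => h ?_
    have hu' := abs_lt.1 (show |u.im| < Real.pi from hu)
    exact (Real.sin_eq_zero_iff_of_lt_of_lt hu'.1 hu'.2).1 h0

theorem neg_exp_mem_regularPoints_of_mem_strip {u : ℂ} (hu : u ∈ strip) :
    -Complex.exp u ∈ regularPoints := by
  refine ⟨neg_ne_zero.2 (Complex.exp_ne_zero _), fun h => ?_⟩
  refine Complex.slitPlane_ne_zero (one_add_exp_mem_slitPlane hu) ?_
  rw [← h]
  ring

theorem norm_neg_exp_lt_one {u : ℂ} (hu : u.re < 0) : ‖-Complex.exp u‖ < 1 := by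
  rw [norm_neg, Complex.norm_exp]
  simpa using hu

/-- `Φ` is, in the coordinate `u` with `y = -e^u`, the continuation of the hypergeometric series
to the slit plane, and the `d_k` are its coefficients with respect to the solutions at `∞`. -/
structure IsConnection (A : Fin (q + 1) → ℂ) (B : Fin q → ℂ) (d : Fin (q + 1) → ℂ)
    (Φ : ℂ → ℂ) : Prop where
  diff : DifferentiableOn ℂ Φ strip
  left : ∀ u ∈ strip, u.re < 0 → Φ u = powerSum (hypCoeff A B) (-Complex.exp u)
  right : ∀ u ∈ strip, 0 < u.re → Φ u = ∑ k, d k * infJet A B k 0 u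

/-- The horizontal section along the slit plane that begins with the hypergeometric series. -/
theorem NonResonant.exists_flatAlong_strip (hAB : NonResonant A B) :
    ∃ (d : Fin (q + 1) → ℂ) (σ : strip → Fin (q + 1) → ℂ),
      FlatAlong (hypEq A B) (fun u : strip => -Complex.exp u) σ ∧
      (∀ u : strip, (u : ℂ).re < 0 → σ u = fun m : Fin (q + 1) => zeroJet A B m (-Complex.exp u)) ∧
      ∀ u : strip, 0 < (u : ℂ).re →
        σ u = ∑ k, d k • fun m : Fin (q + 1) => infJet A B k m u := by
  have : ContractibleSpace strip := convex_strip.contractibleSpace ⟨0, ofReal_mem_strip 0⟩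
  have : LocallyPathConnectedSpace strip := isOpen_strip.locallyPathConnectedSpace
  have hcont : ContinuousOn (hypEq A B) regularPoints :=
    (differentiableOn_hypSystem _ _ _).continuousOn
  have hexp : Continuous fun u : strip => -Complex.exp u := by fun_prop
  obtain ⟨σ, hσ, hσ0⟩ := exists_flatAlong isOpen_regularPoints
    (differentiableOn_hypSystem q (lowerPoly B) (upperPoly A)) hexp
    (fun u => neg_exp_mem_regularPoints_of_mem_strip u.2) ⟨(-1 : ℝ), ofReal_mem_strip _⟩
    (fun m : Fin (q + 1) => zeroJet A B m (-Complex.exp (-1 : ℝ)))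
  obtain ⟨d, hd⟩ := hAB.exists_eq_sum_infJet (u₀ := (1 : ℝ)) (by simp [rightHalfPlane])
    (σ ⟨(1 : ℝ), ofReal_mem_strip _⟩)
  refine ⟨d, σ, hσ, fun u hu => ?_, fun u hu => ?_⟩
  · let S := strip ∩ {u | u.re < 0}
    have : PreconnectedSpace S := Subtype.preconnectedSpace
      (convex_strip.inter (convex_halfSpace_re_lt 0)).isPreconnected
    let i : S → strip := fun u => ⟨u, u.2.1⟩
    have hi : Continuous i := by fun_prop
    have := (hσ.comp hi).eq isOpen_regularPoints hcont (hexp.comp hi)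
      (fun u => neg_exp_mem_regularPoints_of_mem_strip u.2.1)
      (flatAlong_zeroJet hAB.lower (fun u => neg_ne_zero.2 (Complex.exp_ne_zero _))
        fun u => norm_neg_exp_lt_one u.2.2)
      (t₀ := ⟨(-1 : ℝ), ofReal_mem_strip _, by simp⟩) hσ0
    exact congrFun this ⟨u, u.2, hu⟩
  · let S := strip ∩ {u | 0 < u.re}
    have : PreconnectedSpace S := Subtype.preconnectedSpace
      (convex_strip.inter (convex_halfSpace_re_gt 0)).isPreconnected
    let i : S → strip := fun u => ⟨u, u.2.1⟩
    have hi : Continuous i := by fun_prop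
    have := (hσ.comp hi).eq isOpen_regularPoints hcont (hexp.comp hi)
      (fun u => neg_exp_mem_regularPoints_of_mem_strip u.2.1)
      (FlatAlong.linearCombination (fun k => hAB.flatAlong_infJet k continuous_subtype_val
        fun u : S => u.2.2) d)
      (t₀ := ⟨(1 : ℝ), ofReal_mem_strip _, by simp⟩) hd
    exact congrFun this ⟨u, u.2, hu⟩

/-- The zeroth component of the section, as a function on the strip. -/
theorem isConnection_of_flatAlong {d : Fin (q + 1) → ℂ} {σ : strip → Fin (q + 1) → ℂ}
    (hσ : FlatAlong (hypEq A B) (fun u : strip => -Complex.exp u) σ)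
    (hl : ∀ u : strip, (u : ℂ).re < 0 →
      σ u = fun m : Fin (q + 1) => zeroJet A B m (-Complex.exp u))
    (hr : ∀ u : strip, 0 < (u : ℂ).re →
        σ u = ∑ k, d k • fun m : Fin (q + 1) => infJet A B k m u) :
    ∃ Φ : ℂ → ℂ, IsConnection A B d Φ := by
  classical
  refine ⟨fun u => if h : u ∈ strip then σ ⟨u, h⟩ 0 else 0, ?_, ?_, ?_⟩
  · intro u hu
    obtain ⟨Y, hY, hσY⟩ := hσ ⟨u, hu⟩
    have h1 : DifferentiableAt ℂ (fun w => Y (-Complex.exp w) 0) u := by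
      have h2 : DifferentiableAt ℂ (fun w => -Complex.exp w) u := by fun_prop
      have h3 : DifferentiableAt ℂ Y (-Complex.exp u) := hY.self_of_nhds.differentiableAt
      exact differentiableAt_pi.1 (h3.comp u h2) 0
    refine (h1.congr_of_eventuallyEq ?_).differentiableWithinAt
    have h4 := (isOpen_strip.isOpenEmbedding_subtypeVal.map_nhds_eq ⟨u, hu⟩) ▸
      (Filter.eventually_map (P := fun w => ∀ h : w ∈ strip, σ ⟨w, h⟩ = Y (-Complex.exp w))).2
        (hσY.mono fun w hw _ => hw)
    filter_upwards [h4, isOpen_strip.mem_nhds hu] with w hw hws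
    simp only [hws, dif_pos, hw hws]
  · intro u hu hre
    simp only [hu, dif_pos]
    rw [hl ⟨u, hu⟩ hre]
    simp [zeroJet]
  · intro u hu hre
    simp only [hu, dif_pos]
    rw [hr ⟨u, hu⟩ hre]
    simp

theorem NonResonant.exists_isConnection (hAB : NonResonant A B) :
    ∃ d Φ, IsConnection A B d Φ :=
  let ⟨d, _, hσ, hl, hr⟩ := hAB.exists_flatAlong_strip
  ⟨d, isConnection_of_flatAlong hσ hl hr⟩

theorem eqOn_strip {Φ Ψ : ℂ → ℂ} (hΦ : DifferentiableOn ℂ Φ strip)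
    (hΨ : DifferentiableOn ℂ Ψ strip) (h : ∀ u ∈ strip, u.re < 0 → Φ u = Ψ u) :
    Set.EqOn Φ Ψ strip :=
  eqOn_of_eqOn_open isOpen_strip convex_strip.isPreconnected hΦ hΨ
    (isOpen_lt Complex.continuous_re continuous_const)
    ⟨((-1 : ℝ) : ℂ), ofReal_mem_strip _, by simp⟩ h

theorem NonResonant.eq_of_sum_infJet_eq (hAB : NonResonant A B) {d e : Fin (q + 1) → ℂ}
    (h : ∀ u ∈ strip, 0 < u.re → ∑ k, d k * infJet A B k 0 u = ∑ k, e k * infJet A B k 0 u) :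
    d = e := by
  have hd : ∀ d : Fin (q + 1) → ℂ,
      DifferentiableOn ℂ (fun u => ∑ k, d k * infJet A B k 0 u) rightHalfPlane := fun d =>
    DifferentiableOn.fun_sum fun k _ => (hAB.differentiableOn_infJet k 0).const_mul _
  have := eqOn_of_eqOn_open isOpen_rightHalfPlane convex_rightHalfPlane.isPreconnected (hd d)
    (hd e) isOpen_strip ⟨((1 : ℝ) : ℂ), by simp [rightHalfPlane], ofReal_mem_strip _⟩
    fun u hu hu' => h u hu' hu
  refine sub_eq_zero.1 (hAB.eq_zero_of_sum_infJet_eq_zero fun u hu => ?_)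
  simp only [Pi.sub_apply, sub_mul, Finset.sum_sub_distrib]
  exact sub_eq_zero.2 (this hu)

end Connection

/-! ### Contiguity relations -/

section Contiguity

open Function

variable {q : ℕ} {A : Fin (q + 1) → ℂ} {B : Fin q → ℂ}

theorem add_mul_ascPochhammer (x : ℂ) (n : ℕ) :
    (x + n) * (ascPochhammer ℂ n).eval x = x * (ascPochhammer ℂ n).eval (x + 1) := by
  induction n with
  | zero => simp
  | succ n ih =>
    simp only [ascPochhammer_succ_eval]
    push_cast
    linear_combination (x + 1 + n) * ih

theorem ascPochhammer_succ_eval' (x : ℂ) (n : ℕ) :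
    (ascPochhammer ℂ (n + 1)).eval x = x * (ascPochhammer ℂ n).eval (x + 1) := by
  rw [ascPochhammer_succ_eval, ← add_mul_ascPochhammer, mul_comm]

/-- The dependence of a product on one of its parameters is through a single factor. -/
theorem exists_prod_update {ι : Type*} [Fintype ι] [DecidableEq ι] (f : ℂ → ℂ) (a : ι → ℂ)
    (i : ι) : ∃ R, ∏ j, f (a j) = f (a i) * R ∧ ∀ b, ∏ j, f (update a i b j) = f b * R := by
  refine ⟨∏ j ∈ Finset.univ.erase i, f (a j), (Finset.mul_prod_erase _ _ (Finset.mem_univ i)).symm,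
    fun b => ?_⟩
  rw [← Finset.mul_prod_erase _ _ (Finset.mem_univ i), update_self]
  refine congrArg _ (Finset.prod_congr rfl fun j hj => ?_)
  rw [update_of_ne (Finset.ne_of_mem_erase hj)]

theorem ne_neg_nat_update {ι : Type*} [DecidableEq ι] {b : ι → ℂ} (hb : ∀ j, ∀ m : ℕ, b j ≠ -m)
    (i : ι) (j : ι) (m : ℕ) : update b i (b i + 1) j ≠ -m := by
  rcases eq_or_ne j i with rfl | h
  · rw [update_self]
    intro e
    refine hb j (m + 1) ?_
    push_cast
    linear_combination e
  · rw [update_of_ne h]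
    exact hb j m

theorem NonResonant.update_lower (h : NonResonant A B) (j : Fin q) :
    NonResonant A (update B j (B j + 1)) :=
  ⟨ne_neg_nat_update h.lower j, h.diff⟩

theorem NonResonant.update_upper (h : NonResonant A B) (l : Fin (q + 1)) :
    NonResonant (update A l (A l + 1)) B := by
  refine ⟨h.lower, fun i j hij m e => ?_⟩
  rcases eq_or_ne i l with rfl | hi
  · rw [update_self, update_of_ne hij.symm] at e
    refine h.diff i j hij (m - 1) ?_
    push_cast
    linear_combination e
  · rw [update_of_ne hi] at e
    rcases eq_or_ne j l with rfl | hj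
    · rw [update_self] at e
      refine h.diff i j hij (m + 1) ?_
      push_cast
      linear_combination e
    · rw [update_of_ne hj] at e
      exact h.diff i j hij m e

theorem hypCoeff_update_lower {p q : ℕ} (A : Fin p → ℂ) {B : Fin q → ℂ}
    (hB : ∀ j, ∀ m : ℕ, B j ≠ -m) (j : Fin q) (n : ℕ) :
    (n + B j) * hypCoeff A (update B j (B j + 1)) n = B j * hypCoeff A B n := by
  obtain ⟨R, hR, hR'⟩ := exists_prod_update (fun b => (ascPochhammer ℂ n).eval b) B j
  have h0 := ascPochhammer_eval_ne_zero (hB j) n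
  have hP : ∏ j, (ascPochhammer ℂ n).eval (B j) ≠ 0 :=
    Finset.prod_ne_zero_iff.2 fun j _ => ascPochhammer_eval_ne_zero (hB j) n
  have h1 : (ascPochhammer ℂ n).eval (B j + 1) ≠ 0 := by
    simpa using ascPochhammer_eval_ne_zero (ne_neg_nat_update hB j j) n
  have hRne : R ≠ 0 := fun h => hP (by rw [hR, h, mul_zero])
  have h3 : (n.factorial : ℂ) ≠ 0 := by exact_mod_cast n.factorial_ne_zero
  have := add_mul_ascPochhammer (B j) n
  rw [hypCoeff, hypCoeff, hR, hR']
  field_simp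
  linear_combination (∏ i, (ascPochhammer ℂ n).eval (A i)) * this

theorem hypCoeff_update_upper {p q : ℕ} (A : Fin p → ℂ) (B : Fin q → ℂ) (i : Fin p) (n : ℕ) :
    (n + A i) * hypCoeff A B n = A i * hypCoeff (update A i (A i + 1)) B n := by
  obtain ⟨R, hR, hR'⟩ := exists_prod_update (fun b => (ascPochhammer ℂ n).eval b) A i
  have := add_mul_ascPochhammer (A i) n
  rw [hypCoeff, hypCoeff, hR, hR', mul_div_assoc', mul_div_assoc']
  congr 1
  linear_combination R * this

theorem hypCoeff_succ_eq_shift {p q : ℕ} (A : Fin p → ℂ) (B : Fin q → ℂ) (n : ℕ) :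
    (n + 1) * hypCoeff A B (n + 1) =
      (∏ i, A i) / (∏ j, B j) * hypCoeff (fun i => A i + 1) (fun j => B j + 1) n := by
  have h3 : (n + 1 : ℂ) ≠ 0 := by exact_mod_cast n.succ_ne_zero
  simp only [hypCoeff, ascPochhammer_succ_eval', Finset.prod_mul_distrib, Nat.factorial_succ]
  push_cast
  rw [div_mul_div_comm, ← mul_assoc, mul_right_comm, mul_comm _ ((n : ℂ) + 1),
    ← mul_div_assoc, mul_assoc _ _ ((n.factorial : ℂ))]
  exact mul_div_mul_left _ _ h3

theorem infCoeff_update_lower (A : Fin (q + 1) → ℂ) (B : Fin q → ℂ) (j : Fin q)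
    (k : Fin (q + 1)) (n : ℕ) :
    (B j - A k + (-1) * n) * infCoeff A (update B j (B j + 1)) k n =
      (B j - A k) * infCoeff A B k n := by
  obtain ⟨R, hR, hR'⟩ := exists_prod_update
    (fun b => (ascPochhammer ℂ n).eval (A k - b + 1)) B j
  have := add_mul_ascPochhammer (A k - B j) n
  rw [infCoeff, infCoeff, hypCoeff, hypCoeff, Fin.prod_univ_succ, Fin.prod_univ_succ]
  simp only [infUpper, Fin.cons_zero, Fin.cons_succ]
  rw [hR, hR', mul_div_assoc', mul_div_assoc']
  congr 1
  have e : A k - (B j + 1) + 1 = A k - B j := by ring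
  rw [e]
  linear_combination (-(ascPochhammer ℂ n).eval (A k) * R) * this

theorem NonResonant.infCoeff_update_upper (h : NonResonant A B) {i k : Fin (q + 1)} (hik : k ≠ i)
    (n : ℕ) :
    (A i - A k + (-1) * n) * infCoeff A B k n =
      (A i - A k) * infCoeff (update A i (A i + 1)) B k n := by
  obtain ⟨i, rfl⟩ := Fin.exists_succAbove_eq hik.symm
  set A' := update A (k.succAbove i) (A (k.succAbove i) + 1) with hA'
  have hk : A' k = A k := update_of_ne hik _ _
  have e1 : infUpper A' B k = infUpper A B k := by simp only [infUpper, hk]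
  have e2 : infLower A k = update (infLower A' k) i (infLower A' k i + 1) := by
    funext l
    rcases eq_or_ne l i with rfl | hl
    · simp only [infLower]
      rw [update_self, hk, hA', update_self]
      ring
    · rw [update_of_ne hl]
      simp only [infLower]
      rw [hk, hA', update_of_ne (fun e => hl (Fin.succAbove_right_injective e))]
  have := hypCoeff_update_lower (infUpper A' B k)
    ((h.update_upper (k.succAbove i)).infLower_ne k) i n
  rw [← e2] at this
  have e3 : infLower A' k i = A k - A (k.succAbove i) := by
    simp only [infLower]
    rw [hk, hA', update_self]
    ring
  rw [e3] at this
  change _ * hypCoeff (infUpper A' B k) _ n = _ * infCoeff A' B k n at this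
  rw [infCoeff, ← e1]
  linear_combination -this

/-- The derivative of a hypergeometric series is one with all parameters raised by `1`; for the
`i`-th series at infinity, this amounts to raising `A_i`. -/
theorem infCoeff_succ_eq_shift (A : Fin (q + 1) → ℂ) (B : Fin q → ℂ) (i : Fin (q + 1)) (n : ℕ) :
    (n + 1) * infCoeff A B i (n + 1) =
      (∏ l, infUpper A B i l) / (∏ l, infLower A i l) *
        infCoeff (update A i (A i + 1)) B i n := by
  rw [infCoeff, hypCoeff_succ_eq_shift, infCoeff]
  congr 2
  · funext l
    refine Fin.cases ?_ (fun l => ?_) l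
    · simp [infUpper]
    · simp only [infUpper, Fin.cons_succ, update_self]
      ring
  · funext l
    simp only [infLower, update_self]
    rw [update_of_ne (Fin.succAbove_ne i l)]
    ring

/-- The Euler operator `θ + a`, applied to a power series in `y = -e^u`. -/
theorem deriv_add_mul_eq_left {c : ℕ → ℂ} (hc : ConvergesOnDisc c) {Φ : ℂ → ℂ}
    (h : ∀ u ∈ strip, u.re < 0 → Φ u = powerSum c (-Complex.exp u)) (a : ℂ) {u : ℂ}
    (hu : u ∈ strip) (hre : u.re < 0) :
    deriv Φ u + a * Φ u = powerSum (fun n => (n + a) * c n) (-Complex.exp u) := by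
  have hw := norm_neg_exp_lt_one hre
  have h1 : HasDerivAt (fun u => -Complex.exp u) (-Complex.exp u) u :=
    (Complex.hasDerivAt_exp u).fun_neg
  have h2 := (hasDerivAt_powerSum hc hw).comp u h1
  have h3 : Φ =ᶠ[𝓝 u] fun u => powerSum c (-Complex.exp u) := by
    filter_upwards [isOpen_strip.mem_nhds hu,
      (isOpen_lt Complex.continuous_re continuous_const).mem_nhds hre] with v hv hv'
    exact h v hv hv'
  have h4 : deriv Φ u = _ := h3.deriv_eq.trans h2.deriv
  rw [h4, mul_comm _ (-Complex.exp u), mul_powerSum_deriv hc hw, h u hu hre, powerSum, powerSum,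
    powerSum, ← tsum_mul_left, ← Summable.tsum_add]
  · exact tsum_congr fun n => by ring
  · exact ConvergesOnDisc.summable (by simpa using hc.affine_mul 0 1) hw
  · exact (hc.summable hw).mul_left a

/-- The Euler operator `θ + a`, applied to a sum of solutions at infinity. -/
theorem NonResonant.deriv_add_mul_eq_right (hAB : NonResonant A B) {d : Fin (q + 1) → ℂ}
    {Φ : ℂ → ℂ} (h : ∀ u ∈ strip, 0 < u.re → Φ u = ∑ k, d k * infJet A B k 0 u) (a : ℂ) {u : ℂ}
    (hu : u ∈ strip) (hre : 0 < u.re) :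
    deriv Φ u + a * Φ u = ∑ k, d k * (Complex.exp (-A k * u) *
      powerSum (fun n => (a - A k + (-1) * n) * infCoeff A B k n) (-Complex.exp (-u))) := by
  have hw := norm_neg_exp_neg_lt_one hre
  have h2 : HasDerivAt (fun u => ∑ k, d k * infJet A B k 0 u)
      (∑ k, d k * infJet A B k 1 u) u :=
    HasDerivAt.fun_sum fun k _ => (hAB.hasDerivAt_infJet k 0 hre).const_mul _
  have h3 : Φ =ᶠ[𝓝 u] fun u => ∑ k, d k * infJet A B k 0 u := by
    filter_upwards [isOpen_strip.mem_nhds hu, isOpen_rightHalfPlane.mem_nhds hre] with v hv hv'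
    exact h v hv hv'
  have h4 : deriv Φ u = _ := h3.deriv_eq.trans h2.deriv
  rw [h4, h u hu hre, Finset.mul_sum, ← Finset.sum_add_distrib]
  refine Finset.sum_congr rfl fun k _ => ?_
  have hc := hAB.convergesOnDisc_infCoeff k
  have e : powerSum (fun n => (a - A k + (-1) * n) * infCoeff A B k n) (-Complex.exp (-u)) =
      powerSum (fun n => (-A k + (-1) * n) ^ 1 * infCoeff A B k n) (-Complex.exp (-u)) +
        a * powerSum (infCoeff A B k) (-Complex.exp (-u)) := by
    rw [powerSum, powerSum, powerSum, ← tsum_mul_left, ← Summable.tsum_add]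
    · exact tsum_congr fun n => by ring
    · exact (hc.affine_pow_mul (-A k) (-1) 1).summable hw
    · exact (hc.summable hw).mul_left a
  rw [e, infJet_order_zero, infJet]
  ring

theorem IsConnection.differentiableOn_deriv_add {d : Fin (q + 1) → ℂ} {Φ : ℂ → ℂ}
    (h : IsConnection A B d Φ) (a : ℂ) :
    DifferentiableOn ℂ (fun u => deriv Φ u + a * Φ u) strip :=
  (h.diff.deriv isOpen_strip).add (h.diff.const_mul a)

/-- The coefficient of the `k`-th solution at infinity is the expected quotient of Gamma
functions. -/
def ConnectionFormula (A : Fin (q + 1) → ℂ) (B : Fin q → ℂ) (k : Fin (q + 1)) : Prop :=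
  ∀ d Φ, IsConnection A B d Φ → d k = connCoeff A B k

/-- How the connection coefficients change with `B_j`, by comparison of both ends of
`B_j F(A; B) = (θ + B_j) F(A; B + e_j)`. -/
theorem NonResonant.lower_mul_coeff (hAB : NonResonant A B) (j : Fin q)
    {d d' : Fin (q + 1) → ℂ} {Φ Φ' : ℂ → ℂ} (h : IsConnection A B d Φ)
    (h' : IsConnection A (update B j (B j + 1)) d' Φ') (k : Fin (q + 1)) :
    B j * d k = (B j - A k) * d' k := by
  have hAB' := hAB.update_lower j
  have e := eqOn_strip (h.diff.const_mul (B j)) (h'.differentiableOn_deriv_add (B j))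
    fun u hu hre => by
      rw [deriv_add_mul_eq_left (convergesOnDisc_hypCoeff A hAB'.lower) h'.left (B j) hu hre,
        h.left u hu hre]
      simp only [hypCoeff_update_lower A hAB.lower]
      rw [powerSum_const_mul]
  refine congrFun (hAB.eq_of_sum_infJet_eq (d := fun k => B j * d k)
    (e := fun k => (B j - A k) * d' k) fun u hu hre => ?_) k
  have := e hu
  simp only [hAB'.deriv_add_mul_eq_right h'.right (B j) hu hre, h.right u hu hre,
    infCoeff_update_lower, powerSum_const_mul, Finset.mul_sum] at this
  simp only [mul_assoc]
  refine this.trans (Finset.sum_congr rfl fun k _ => ?_)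
  rw [infJet_order_zero]
  ring

/-- How the connection coefficients change with `A_i`, by comparison of both ends of
`A_i F(A + e_i; B) = (θ + A_i) F(A; B)`. Nothing is said about the `i`-th coefficient, whose leading
term is annihilated by `θ + A_i`. -/
theorem NonResonant.upper_mul_coeff (hAB : NonResonant A B) {i k : Fin (q + 1)} (hik : k ≠ i)
    {d d' : Fin (q + 1) → ℂ} {Φ Φ' : ℂ → ℂ} (h : IsConnection A B d Φ)
    (h' : IsConnection (update A i (A i + 1)) B d' Φ') :
    (A i - A k) * d k = A i * d' k := by
  have hAB' := hAB.update_upper i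
  set E := (∏ l, infUpper A B i l) / (∏ l, infLower A i l)
  have e := eqOn_strip (h'.diff.const_mul (A i)) (h.differentiableOn_deriv_add (A i))
    fun u hu hre => by
      rw [deriv_add_mul_eq_left (convergesOnDisc_hypCoeff A hAB.lower) h.left (A i) hu hre,
        h'.left u hu hre]
      simp only [hypCoeff_update_upper A]
      rw [powerSum_const_mul]
  have key := congrFun (hAB'.eq_of_sum_infJet_eq (d := fun k => A i * d' k)
    (e := fun k => if k = i then E * d k else (A i - A k) * d k) fun u hu hre => ?_) k
  · rw [if_neg hik] at key
    exact key.symm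
  have hw := norm_neg_exp_neg_lt_one hre
  have := e hu
  simp only [hAB.deriv_add_mul_eq_right h.right (A i) hu hre, h'.right u hu hre,
    Finset.mul_sum] at this
  simp only [mul_assoc]
  refine this.trans (Finset.sum_congr rfl fun k _ => ?_)
  rw [infJet_order_zero]
  split_ifs with hki
  · subst hki
    -- the leading term is killed, and the exponent of what remains is `A_k + 1`
    have hc : ConvergesOnDisc fun n => (A k - A k + (-1) * n) * infCoeff A B k n :=
      (hAB.convergesOnDisc_infCoeff k).affine_mul _ _
    have e1 : powerSum (fun n => (A k - A k + (-1) * n) * infCoeff A B k n) (-Complex.exp (-u)) =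
        -Complex.exp (-u) *
          powerSum (fun n => -E * infCoeff (update A k (A k + 1)) B k n) (-Complex.exp (-u)) :=
      mul_powerSum_shift_eq hc hw (by simp) fun n => by
        have hs := infCoeff_succ_eq_shift A B k n
        change _ = E * _ at hs
        push_cast
        linear_combination -hs
    have e2 : Complex.exp (-(A k + 1) * u) = Complex.exp (-A k * u) * Complex.exp (-u) := by
      rw [← Complex.exp_add]
      congr 1
      ring
    rw [e1, powerSum_const_mul, update_self, e2]
    ring
  · simp only [hAB.infCoeff_update_upper hki, powerSum_const_mul]
    rw [update_of_ne hki]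
    ring

theorem lower_mul_connCoeff (hB : ∀ j, ∀ m : ℕ, B j ≠ -m) (j : Fin q) (k : Fin (q + 1)) :
    B j * connCoeff A B k = (B j - A k) * connCoeff A (update B j (B j + 1)) k := by
  obtain ⟨R, hR, hR'⟩ := exists_prod_update
    (fun b => Complex.Gamma b / Complex.Gamma (b - A k)) B j
  have h0 : B j ≠ 0 := by simpa using hB j 0
  rw [connCoeff, connCoeff, hR, hR', Complex.Gamma_add_one _ h0]
  -- if `B j = A k`, the left side is zero because of `1 / Γ(0) = 0`
  by_cases h : B j - A k = 0
  · rw [h, Complex.Gamma_zero]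
    simp
  · rw [show B j + 1 - A k = B j - A k + 1 by ring, Complex.Gamma_add_one _ h]
    rw [mul_comm (B j - A k) (Complex.Gamma _), ← div_div]
    field_simp

theorem prod_erase_eq_prod_succAbove (f : Fin (q + 1) → ℂ) (k : Fin (q + 1)) :
    ∏ j ∈ Finset.univ.erase k, f j = ∏ i, f (k.succAbove i) := by
  rw [Fin.univ_succAbove _ k, Finset.erase_cons, Finset.prod_map]
  rfl

theorem upper_mul_connCoeff (hAB : NonResonant A B) {i k : Fin (q + 1)} (hik : k ≠ i) :
    (A i - A k) * connCoeff A B k = A i * connCoeff (update A i (A i + 1)) B k := by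
  have hne : A i - A k ≠ 0 := by simpa using hAB.diff i k hik.symm 0
  obtain ⟨i, rfl⟩ := Fin.exists_succAbove_eq hik.symm
  obtain ⟨R, hR, hR'⟩ := exists_prod_update
    (fun a => Complex.Gamma (a - A k) / Complex.Gamma a) (fun l => A (k.succAbove l)) i
  have e : ∀ l, update A (k.succAbove i) (A (k.succAbove i) + 1) (k.succAbove l) =
      update (fun l => A (k.succAbove l)) i (A (k.succAbove i) + 1) l := fun l =>
    congrFun (update_comp_eq_of_injective A Fin.succAbove_right_injective i _) l
  rw [connCoeff, connCoeff, prod_erase_eq_prod_succAbove, prod_erase_eq_prod_succAbove,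
    update_of_ne hik]
  simp only [e]
  rw [hR, hR', show A (k.succAbove i) + 1 - A k = A (k.succAbove i) - A k + 1 by ring,
    Complex.Gamma_add_one _ hne]
  -- if the parameter is zero, the left side is zero because of `1 / Γ(0) = 0`
  by_cases h : A (k.succAbove i) = 0
  · rw [h, Complex.Gamma_zero]
    simp
  · rw [Complex.Gamma_add_one _ h]
    field_simp

theorem ConnectionFormula.of_update_lower (hAB : NonResonant A B) {j : Fin q}
    {k : Fin (q + 1)} (h : ConnectionFormula A (update B j (B j + 1)) k) :
    ConnectionFormula A B k := by
  intro d Φ hd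
  obtain ⟨d', Φ', hd'⟩ := (hAB.update_lower j).exists_isConnection
  have h0 : B j ≠ 0 := by simpa using hAB.lower j 0
  refine mul_left_cancel₀ h0 ?_
  rw [hAB.lower_mul_coeff j hd hd', h d' Φ' hd', lower_mul_connCoeff hAB.lower]

theorem ConnectionFormula.of_update_upper (hAB : NonResonant A B) {i k : Fin (q + 1)}
    (hik : k ≠ i) (h : ConnectionFormula (update A i (A i + 1)) B k) :
    ConnectionFormula A B k := by
  intro d Φ hd
  obtain ⟨d', Φ', hd'⟩ := (hAB.update_upper i).exists_isConnection
  have hne : A i - A k ≠ 0 := by simpa using hAB.diff i k hik.symm 0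
  refine mul_left_cancel₀ hne ?_
  rw [hAB.upper_mul_coeff hik hd hd', h d' Φ' hd', upper_mul_connCoeff hAB hik]

/-- A property that descends from `a + e_i` to `a`, for `i ∈ S`, has to be proved only if the
`a_i` with `i ∈ S` have large real parts. -/
theorem shift_induction {ι : Type*} [DecidableEq ι] (S : Finset ι) (T : ℝ) {p : (ι → ℂ) → Prop}
    (base : ∀ a, (∀ i ∈ S, T ≤ (a i).re) → p a)
    (step : ∀ a, ∀ i ∈ S, p (update a i (a i + 1)) → p a) (a : ι → ℂ) : p a := by
  induction hn : ∑ i ∈ S, ⌈T - (a i).re⌉₊ using Nat.strong_induction_on generalizing a with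
  | _ n ih =>
    by_cases h : ∀ i ∈ S, T ≤ (a i).re
    · exact base a h
    · push Not at h
      obtain ⟨i, hi, hlt⟩ := h
      refine step a i hi (ih _ ?_ _ rfl)
      rw [← hn]
      refine Finset.sum_lt_sum (fun j _ => ?_) ⟨i, hi, ?_⟩
      · rcases eq_or_ne j i with rfl | hj
        · rw [update_self]
          exact Nat.ceil_mono (by rw [Complex.add_re, Complex.one_re]; linarith)
        · rw [update_of_ne hj]
      · rw [update_self, Complex.add_re, Complex.one_re, ← sub_sub, Nat.ceil_sub_one]
        exact Nat.sub_lt (Nat.ceil_pos.2 (sub_pos.2 hlt)) one_pos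

end Contiguity

/-! ### Euler's integral -/

section Euler

open MeasureTheory

/-- The integrand `t^(a-1) (1-t)^(b-1)` of the Beta integral. -/
noncomputable def betaWeight (a b : ℂ) (t : ℝ) : ℂ := (t : ℂ) ^ (a - 1) * (1 - (t : ℂ)) ^ (b - 1)

theorem integrableOn_betaWeight {a b : ℂ} (ha : 0 < a.re) (hb : 0 < b.re) :
    IntegrableOn (betaWeight a b) (Set.Ioo 0 1) :=
  (intervalIntegrable_iff_integrableOn_Ioo_of_le zero_le_one).1
    (Complex.betaIntegral_convergent ha hb)

theorem integral_betaWeight {a b : ℂ} (ha : 0 < a.re) (hb : 0 < b.re) :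
    ∫ t in Set.Ioo 0 1, betaWeight a b t =
      Complex.Gamma a * Complex.Gamma b / Complex.Gamma (a + b) := by
  have h : Complex.Gamma (a + b) ≠ 0 :=
    Complex.Gamma_ne_zero_of_re_pos (by rw [Complex.add_re]; linarith)
  rw [eq_div_iff h, mul_comm, Complex.Gamma_mul_Gamma_eq_betaIntegral ha hb,
    Complex.betaIntegral, intervalIntegral.integral_of_le zero_le_one, integral_Ioc_eq_integral_Ioo]
  rfl

/-- A power of `t` moves the first parameter of the weight. -/
theorem betaWeight_mul_cpow (a b c : ℂ) {t : ℝ} (ht : 0 < t) :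
    betaWeight a b t * (t : ℂ) ^ c = betaWeight (a + c) b t := by
  have h : (t : ℂ) ≠ 0 := by exact_mod_cast ht.ne'
  rw [betaWeight, betaWeight, mul_right_comm, ← Complex.cpow_add _ _ h]
  congr 2
  ring

/-- `Φ` is bounded on the left part of a narrower strip: near `-∞` it is a power series in the small
quantity `-e^u`, and what remains is compact. -/
theorem exists_bound_substrip {c : ℕ → ℂ} (hc : ConvergesOnDisc c) {Φ : ℂ → ℂ}
    (hΦ : DifferentiableOn ℂ Φ strip)
    (hl : ∀ u ∈ strip, u.re < 0 → Φ u = powerSum c (-Complex.exp u)) {δ : ℝ} (hδ : δ < Real.pi)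
    (R : ℝ) : ∃ C, ∀ u : ℂ, |u.im| ≤ δ → u.re ≤ R → ‖Φ u‖ ≤ C := by
  have h1 : ContinuousOn (powerSum c) (Metric.closedBall 0 (Real.exp (-1))) := fun w hw =>
    (hasDerivAt_powerSum hc ((mem_closedBall_zero_iff.1 hw).trans_lt
      (by simp))).continuousAt.continuousWithinAt
  obtain ⟨C₁, hC₁⟩ := (isCompact_closedBall (0 : ℂ) (Real.exp (-1))).exists_bound_of_continuousOn h1
  have hK : IsCompact (Set.Icc (-1) R ×ℂ Set.Icc (-δ) δ) := isCompact_Icc.reProdIm isCompact_Icc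
  have hKs : Set.Icc (-1) R ×ℂ Set.Icc (-δ) δ ⊆ strip := fun u hu =>
    (abs_le.2 (Complex.mem_reProdIm.1 hu).2).trans_lt hδ
  obtain ⟨C₂, hC₂⟩ := hK.exists_bound_of_continuousOn (hΦ.continuousOn.mono hKs)
  refine ⟨max C₁ C₂, fun u hu huR => ?_⟩
  rcases le_total u.re (-1) with h | h
  · rw [hl u (hu.trans_lt hδ) (by linarith)]
    refine (hC₁ _ ?_).trans (le_max_left _ _)
    rw [mem_closedBall_zero_iff, norm_neg, Complex.norm_exp]
    exact Real.exp_le_exp.2 h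
  · exact (hC₂ u (Complex.mem_reProdIm.2 ⟨⟨h, huR⟩, abs_le.1 hu⟩)).trans (le_max_right _ _)

theorem add_log_mem_strip {u : ℂ} (hu : u ∈ strip) (t : ℝ) : u + (Real.log t : ℂ) ∈ strip := by
  have : |u.im| < Real.pi := hu
  change |(u + (Real.log t : ℂ)).im| < Real.pi
  simpa using this

theorem aestronglyMeasurable_add_log {Φ : ℂ → ℂ} (hΦ : ContinuousOn Φ strip) {u : ℂ}
    (hu : u ∈ strip) :
    AEStronglyMeasurable (fun t : ℝ => Φ (u + (Real.log t : ℂ)))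
      (volume.restrict (Set.Ioo 0 1)) := by
  refine ContinuousOn.aestronglyMeasurable ?_ measurableSet_Ioo
  refine hΦ.comp (fun t ht => ContinuousAt.continuousWithinAt ?_)
    fun t _ => add_log_mem_strip hu t
  have : ContinuousAt Real.log t := Real.continuousAt_log ht.1.ne'
  fun_prop

/-- In the coordinate `u`, the substitution of `t y` for `y` is a translation by `log t`. -/
theorem differentiableOn_eulerIntegral {a b : ℂ} (ha : 0 < a.re) (hb : 0 < b.re) {c : ℕ → ℂ}
    (hc : ConvergesOnDisc c) {Φ : ℂ → ℂ} (hΦ : DifferentiableOn ℂ Φ strip)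
    (hl : ∀ u ∈ strip, u.re < 0 → Φ u = powerSum c (-Complex.exp u)) :
    DifferentiableOn ℂ (fun u => ∫ t in Set.Ioo 0 1, betaWeight a b t * Φ (u + (Real.log t : ℂ)))
      strip := by
  intro u₀ hu₀
  have hu₀' : |u₀.im| < Real.pi := hu₀
  obtain ⟨δ, hδ₀, hδ⟩ := exists_between hu₀'
  have hΦ' : DifferentiableOn ℂ (deriv Φ) strip := hΦ.deriv isOpen_strip
  have hl' : ∀ u ∈ strip, u.re < 0 →
      deriv Φ u = powerSum (fun n => (n : ℂ) * c n) (-Complex.exp u) := fun u hu hre => by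
    simpa using deriv_add_mul_eq_left hc hl 0 hu hre
  obtain ⟨C, hC⟩ := exists_bound_substrip hc hΦ hl hδ (u₀.re + 1)
  obtain ⟨C', hC'⟩ := exists_bound_substrip (by simpa using hc.affine_mul 0 1) hΦ' hl' hδ
    (u₀.re + 1)
  set s : Set ℂ := {u | |u.im| < δ} ∩ {u | u.re < u₀.re + 1} with hs
  have hsn : s ∈ 𝓝 u₀ := ((isOpen_lt (by fun_prop) continuous_const).inter
    (isOpen_lt Complex.continuous_re continuous_const)).mem_nhds ⟨hδ₀, by simp⟩
  have hss : s ⊆ strip := fun u hu => (show |u.im| < δ from hu.1).trans hδ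
  have hsl : ∀ u ∈ s, ∀ t ∈ Set.Ioo (0 : ℝ) 1, |(u + (Real.log t : ℂ)).im| ≤ δ ∧
      (u + (Real.log t : ℂ)).re ≤ u₀.re + 1 := fun u hu t ht => by
    have h1 : |u.im| < δ := hu.1
    have h2 : u.re < u₀.re + 1 := hu.2
    have h3 := Real.log_neg ht.1 ht.2
    refine ⟨by simpa using h1.le, ?_⟩
    rw [Complex.add_re, Complex.ofReal_re]
    linarith
  have hw := integrableOn_betaWeight ha hb
  have hmeas : ∀ u ∈ strip, AEStronglyMeasurable
      (fun t : ℝ => betaWeight a b t * Φ (u + (Real.log t : ℂ))) (volume.restrict (Set.Ioo 0 1)) :=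
    fun u hu => hw.aestronglyMeasurable.mul (aestronglyMeasurable_add_log hΦ.continuousOn hu)
  have hae : ∀ᵐ t ∂(volume.restrict (Set.Ioo (0 : ℝ) 1)), t ∈ Set.Ioo (0 : ℝ) 1 :=
    ae_restrict_mem measurableSet_Ioo
  have hus : u₀ ∈ s := mem_of_mem_nhds hsn
  refine (hasDerivAt_integral_of_dominated_loc_of_deriv_le (μ := volume.restrict (Set.Ioo 0 1))
    (F := fun u t => betaWeight a b t * Φ (u + (Real.log t : ℂ)))
    (F' := fun u t => betaWeight a b t * deriv Φ (u + (Real.log t : ℂ)))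
    (bound := fun t => ‖betaWeight a b t‖ * C') hsn ?_ ?_ ?_ ?_ ?_
    ?_).2.differentiableAt.differentiableWithinAt
  · filter_upwards [hsn] with u hu using hmeas u (hss hu)
  · refine Integrable.mono' (hw.norm.mul_const C) (hmeas u₀ hu₀) ?_
    filter_upwards [hae] with t ht
    rw [norm_mul]
    exact mul_le_mul_of_nonneg_left (hC _ (hsl u₀ hus t ht).1 (hsl u₀ hus t ht).2) (norm_nonneg _)
  · exact hw.aestronglyMeasurable.mul (aestronglyMeasurable_add_log hΦ'.continuousOn hu₀)
  · filter_upwards [hae] with t ht u hu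
    rw [norm_mul]
    exact mul_le_mul_of_nonneg_left (hC' _ (hsl u hu t ht).1 (hsl u hu t ht).2) (norm_nonneg _)
  · exact hw.norm.mul_const C'
  · filter_upwards [hae] with t ht u hu
    have h1 : DifferentiableAt ℂ Φ (u + (Real.log t : ℂ)) :=
      hΦ.differentiableAt (isOpen_strip.mem_nhds (add_log_mem_strip (hss hu) t))
    exact (h1.hasDerivAt.comp_add_const u _).const_mul _

/-- Termwise integration of the hypergeometric series against the Beta density. -/
theorem eulerIntegral_powerSum {a b : ℂ} (ha : 0 < a.re) (hb : 0 < b.re) {c : ℕ → ℂ}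
    (hc : ConvergesOnDisc c) {u : ℂ} (hre : u.re < 0) :
    ∫ t in Set.Ioo 0 1, betaWeight a b t * powerSum c (-Complex.exp (u + (Real.log t : ℂ))) =
      powerSum (fun n => c n *
        (Complex.Gamma (a + n) * Complex.Gamma b / Complex.Gamma (a + n + b)))
        (-Complex.exp u) := by
  have hw := norm_neg_exp_lt_one hre
  have e : ∀ n : ℕ, ∀ t ∈ Set.Ioo (0 : ℝ) 1,
      betaWeight a b t * (c n * (-Complex.exp (u + (Real.log t : ℂ))) ^ n) =
        c n * (-Complex.exp u) ^ n * betaWeight (a + n) b t := by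
    intro n t ht
    rw [← betaWeight_mul_cpow _ _ _ ht.1, Complex.cpow_natCast, Complex.exp_add,
      ← Complex.ofReal_exp, Real.exp_log ht.1, ← neg_mul, mul_pow]
    ring
  have hre' : ∀ n : ℕ, 0 < (a + n).re := fun n => by
    rw [Complex.add_re, Complex.natCast_re]
    positivity
  have hint : ∀ n : ℕ, IntegrableOn
      (fun t => c n * (-Complex.exp u) ^ n * betaWeight (a + n) b t) (Set.Ioo 0 1) := fun n =>
    (integrableOn_betaWeight (hre' n) hb).const_mul _
  have hsum : Summable fun n : ℕ => ∫ t in Set.Ioo (0 : ℝ) 1,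
      ‖c n * (-Complex.exp u) ^ n * betaWeight (a + n) b t‖ := by
    refine Summable.of_nonneg_of_le (fun n => integral_nonneg fun t => norm_nonneg _) (fun n => ?_)
      ((hc.summable hw).norm.mul_right (∫ t in Set.Ioo (0 : ℝ) 1, ‖betaWeight a b t‖))
    rw [← integral_const_mul]
    refine setIntegral_mono_on (hint n).norm ((integrableOn_betaWeight ha hb).norm.const_mul _)
      measurableSet_Ioo fun t ht => ?_
    rw [norm_mul, ← betaWeight_mul_cpow _ _ _ ht.1, Complex.cpow_natCast,
      norm_mul (betaWeight a b t)]
    refine mul_le_mul_of_nonneg_left (mul_le_of_le_one_right (norm_nonneg _) ?_) (norm_nonneg _)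
    rw [norm_pow, Complex.norm_real, Real.norm_of_nonneg ht.1.le]
    exact pow_le_one₀ ht.1.le ht.2.le
  have h := hasSum_integral_of_summable_integral_norm hint hsum
  have h2 : ∫ t in Set.Ioo 0 1, betaWeight a b t * powerSum c (-Complex.exp (u + (Real.log t : ℂ)))
      = ∫ t in Set.Ioo (0 : ℝ) 1, ∑' n, c n * (-Complex.exp u) ^ n * betaWeight (a + n) b t := by
    refine setIntegral_congr_fun measurableSet_Ioo fun t ht => ?_
    simp only [powerSum, ← tsum_mul_left]
    exact tsum_congr fun n => e n t ht
  rw [h2, ← h.tsum_eq, powerSum]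
  refine tsum_congr fun n => ?_
  rw [integral_const_mul, integral_betaWeight (hre' n) hb]
  ring

end Euler

/-! ### The connection coefficients -/

section Coefficients

open MeasureTheory

variable {q : ℕ} {A : Fin (q + 1) → ℂ} {B : Fin q → ℂ} {d : Fin (q + 1) → ℂ} {Φ : ℂ → ℂ}

/-- If `A_k` has the smallest real part, then the `k`-th solution dominates at infinity, and its
coefficient is a limit. -/
theorem IsConnection.tendsto_coeff (h : IsConnection A B d Φ) (hAB : NonResonant A B)
    {k : Fin (q + 1)} (hk : ∀ i, i ≠ k → (A k).re < (A i).re) :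
    Tendsto (fun t : ℝ => Complex.exp (A k * t) * Φ t) atTop (𝓝 (d k)) := by
  have h1 : ∀ i, Tendsto (fun t : ℝ => d i * (Complex.exp ((A k - A i) * t) *
      powerSum (infCoeff A B i) (-Complex.exp (-t)))) atTop
      (𝓝 (d i * ((if i = k then 1 else 0) * 1))) := by
    intro i
    refine ((Tendsto.mul ?_ (hAB.tendsto_powerSum_infCoeff i)).const_mul _)
    split_ifs with hi
    · subst hi
      simp
    · rw [tendsto_zero_iff_norm_tendsto_zero]
      simp only [Complex.norm_exp, Complex.re_mul_ofReal, Complex.sub_re]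
      refine Real.tendsto_exp_atBot.comp ?_
      exact tendsto_id.const_mul_atTop_of_neg (sub_neg.2 (hk i hi))
  have h2 := tendsto_finsetSum Finset.univ fun i _ => h1 i
  simp only [mul_one, mul_ite, mul_zero, Finset.sum_ite_eq', Finset.mem_univ, if_true] at h2
  refine h2.congr' ?_
  filter_upwards [eventually_gt_atTop 0] with t ht
  rw [h.right _ (ofReal_mem_strip t) (by simpa using ht), Finset.mul_sum]
  refine Finset.sum_congr rfl fun i _ => ?_
  rw [infJet_order_zero, sub_mul, sub_eq_add_neg, Complex.exp_add, ← neg_mul]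
  ring

/-- The bound of the size `(-y)^(-A_k)` on the negative real axis, uniform up to `y = 0`. -/
theorem IsConnection.exists_bound (h : IsConnection A B d Φ) (hAB : NonResonant A B)
    {k : Fin (q + 1)} (hk : ∀ i, i ≠ k → (A k).re < (A i).re) :
    ∃ C, 0 ≤ C ∧ ∀ v : ℝ, ‖Φ v‖ ≤ C * Real.exp (-(A k).re * max v 0) := by
  have h1 := (h.tendsto_coeff hAB hk).norm.eventually_le_const (lt_add_one ‖d k‖)
  obtain ⟨V, hV⟩ := eventually_atTop.1 (h1.and (eventually_ge_atTop 0))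
  have hV0 : 0 ≤ V := (hV V le_rfl).2
  obtain ⟨C₂, hC₂⟩ := exists_bound_substrip (convergesOnDisc_hypCoeff A hAB.lower) h.diff h.left
    Real.pi_pos V
  have hC₂0 : 0 ≤ C₂ := (norm_nonneg _).trans (hC₂ (0 : ℝ) (by simp) (by simpa using hV0))
  refine ⟨max (‖d k‖ + 1) (C₂ * Real.exp (|(A k).re| * V)), by positivity, fun v => ?_⟩
  rcases le_total V v with hv | hv
  · have h2 := (hV v hv).1
    rw [norm_mul, Complex.norm_exp, Complex.re_mul_ofReal] at h2
    rw [max_eq_left (hV0.trans hv)]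
    calc ‖Φ v‖ = (Real.exp ((A k).re * v) * ‖Φ v‖) * Real.exp (-(A k).re * v) := by
          rw [mul_right_comm, ← Real.exp_add]; simp
      _ ≤ (‖d k‖ + 1) * Real.exp (-(A k).re * v) := by gcongr
      _ ≤ _ := by gcongr; exact le_max_left _ _
  · have h3 : (A k).re * max v 0 ≤ |(A k).re| * V :=
      mul_le_mul (le_abs_self _) (max_le hv hV0) (le_max_right _ _) (abs_nonneg _)
    calc ‖Φ v‖ ≤ C₂ := hC₂ v (by simp) (by simpa using hv)
      _ ≤ C₂ * (Real.exp (|(A k).re| * V) * Real.exp (-(A k).re * max v 0)) := by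
          refine le_mul_of_one_le_right hC₂0 ?_
          rw [← Real.exp_add, Real.one_le_exp_iff]
          linarith
      _ ≤ _ := by
          rw [← mul_assoc]
          gcongr
          exact le_max_right _ _

/-- Euler's integral transforms the leading term at infinity as it transforms `(-y)^(-α)`. -/
theorem tendsto_eulerIntegral {a b α D : ℂ} {C : ℝ} (hΦ : ContinuousOn Φ strip)
    (ha : 0 < a.re) (hb : 0 < b.re) (haα : α.re < a.re)
    (hlim : Tendsto (fun t : ℝ => Complex.exp (α * t) * Φ t) atTop (𝓝 D)) (hC0 : 0 ≤ C)
    (hC : ∀ v : ℝ, ‖Φ v‖ ≤ C * Real.exp (-α.re * max v 0)) :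
    Tendsto (fun s : ℝ => Complex.exp (α * s) *
      ∫ t in Set.Ioo 0 1, betaWeight a b t * Φ (s + (Real.log t : ℂ))) atTop
      (𝓝 (D * (Complex.Gamma (a - α) * Complex.Gamma b / Complex.Gamma (a - α + b)))) := by
  -- `t^(-m)`, which does not destroy the convergence at `t = 0`, compensates for the growth of
  -- `e^(αs) Φ(s + log t)` in the range `s + log t < 0` as well as `s + log t > 0`
  set m : ℝ := max α.re 0 with hm
  have ham : 0 < (a + (-m : ℝ)).re := by
    rw [Complex.add_re, Complex.ofReal_re]
    have := max_lt haα ha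
    linarith
  have haα' : 0 < (a - α).re := by rw [Complex.sub_re]; linarith
  rw [← integral_betaWeight haα' hb, ← integral_const_mul]
  simp only [← integral_const_mul]
  have hae : ∀ᵐ t ∂(volume.restrict (Set.Ioo (0 : ℝ) 1)), t ∈ Set.Ioo (0 : ℝ) 1 :=
    ae_restrict_mem measurableSet_Ioo
  refine tendsto_integral_filter_of_dominated_convergence
    (fun t => ‖betaWeight (a + (-m : ℝ)) b t‖ * C) (.of_forall fun s => ?_) ?_ ?_ ?_
  · exact ((integrableOn_betaWeight ha hb).aestronglyMeasurable.mul
      (aestronglyMeasurable_add_log hΦ (ofReal_mem_strip s))).const_mul _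
  · filter_upwards [eventually_ge_atTop 0] with s hs
    filter_upwards [hae] with t ht
    have hlog : Real.log t < 0 := Real.log_neg ht.1 ht.2
    rw [← betaWeight_mul_cpow _ _ _ ht.1, norm_mul, norm_mul, norm_mul, Complex.norm_exp,
      Complex.re_mul_ofReal, ← Complex.ofReal_add, Complex.norm_cpow_eq_rpow_re_of_pos ht.1,
      Complex.ofReal_re, Real.rpow_def_of_pos ht.1]
    have h1 : α.re * s + -α.re * max (s + Real.log t) 0 ≤ Real.log t * -m := by
      have e1 : 0 ≤ s - max (s + Real.log t) 0 := by
        rw [sub_nonneg]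
        exact max_le (by linarith) hs
      have e2 : s - max (s + Real.log t) 0 ≤ -Real.log t := by
        have := le_max_left (s + Real.log t) 0
        linarith
      calc α.re * s + -α.re * max (s + Real.log t) 0
          = α.re * (s - max (s + Real.log t) 0) := by ring
        _ ≤ m * (s - max (s + Real.log t) 0) :=
            mul_le_mul_of_nonneg_right (le_max_left _ _) e1
        _ ≤ m * -Real.log t := mul_le_mul_of_nonneg_left e2 (le_max_right _ _)
        _ = _ := by ring
    calc Real.exp (α.re * s) * (‖betaWeight a b t‖ * ‖Φ ((s + Real.log t : ℝ) : ℂ)‖)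
        ≤ Real.exp (α.re * s) * (‖betaWeight a b t‖ *
          (C * Real.exp (-α.re * max (s + Real.log t) 0))) := by gcongr; exact hC _
      _ = ‖betaWeight a b t‖ *
          Real.exp (α.re * s + -α.re * max (s + Real.log t) 0) * C := by
          rw [Real.exp_add]; ring
      _ ≤ _ := by gcongr
  · exact (integrableOn_betaWeight ham hb).norm.mul_const C
  · filter_upwards [hae] with t ht
    have h1 : Tendsto (fun s : ℝ => s + Real.log t) atTop atTop :=
      tendsto_atTop_add_const_right _ _ tendsto_id
    have h2 := (hlim.comp h1).mul_const (betaWeight (a - α) b t)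
    refine h2.congr fun s => ?_
    have h3 : Complex.exp (α * (Real.log t : ℂ)) * (t : ℂ) ^ (-α) = 1 := by
      rw [Complex.cpow_def_of_ne_zero (by exact_mod_cast ht.1.ne'), ← Complex.ofReal_log ht.1.le,
        ← Complex.exp_add]
      simp [mul_comm]
    simp only [Function.comp_apply]
    rw [sub_eq_add_neg, ← betaWeight_mul_cpow _ _ _ ht.1]
    push_cast
    rw [mul_add, Complex.exp_add]
    linear_combination (Complex.exp (α * s) * Φ (s + (Real.log t : ℂ)) * betaWeight a b t) * h3

/-- The series with one more pair of parameters is an Euler integral of the series without it, and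
this determines how the connection coefficient changes. -/
theorem connectionFormula_of_succAbove {A : Fin (q + 2) → ℂ} {B : Fin (q + 1) → ℂ}
    (hAB : NonResonant A B) {p : Fin (q + 2)} {k : Fin (q + 1)}
    (ih : ConnectionFormula (fun i => A (p.succAbove i)) (fun j => B j.castSucc) k)
    (hk : ∀ i, i ≠ p.succAbove k → (A (p.succAbove k)).re < (A i).re) (hp : 0 < (A p).re)
    (hpB : (A p).re < (B (Fin.last q)).re) : ConnectionFormula A B (p.succAbove k) := by
  intro d Φ h
  set A' : Fin (q + 1) → ℂ := fun i => A (p.succAbove i) with hA'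
  set B' : Fin q → ℂ := fun j => B j.castSucc with hB'
  have hAB' : NonResonant A' B' := ⟨fun j => hAB.lower _,
    fun i j hij => hAB.diff _ _ (Fin.succAbove_right_injective.ne hij)⟩
  have hk' : ∀ i, i ≠ k → (A' k).re < (A' i).re := fun i hi =>
    hk _ (Fin.succAbove_right_injective.ne hi)
  obtain ⟨d', Φ', h'⟩ := hAB'.exists_isConnection
  set a := A p
  set b := B (Fin.last q)
  have hba : 0 < (b - a).re := by rw [Complex.sub_re]; linarith
  have hpk : (A' k).re < a.re := hk p (Fin.succAbove_ne p k).symm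
  have hΓa : Complex.Gamma a ≠ 0 := Complex.Gamma_ne_zero_of_re_pos hp
  have hΓb : Complex.Gamma b ≠ 0 := Complex.Gamma_ne_zero (hAB.lower _)
  have hΓba : Complex.Gamma (b - a) ≠ 0 := Complex.Gamma_ne_zero_of_re_pos hba
  have ha : ∀ m : ℕ, a ≠ -m := fun m e => by
    rw [e, Complex.neg_re, Complex.natCast_re] at hp
    have : (0 : ℝ) ≤ m := m.cast_nonneg
    linarith
  have hcoef : ∀ n : ℕ, hypCoeff A' B' n * (Complex.Gamma (a + n) * Complex.Gamma (b - a) /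
      Complex.Gamma (a + n + (b - a))) =
      Complex.Gamma a * Complex.Gamma (b - a) / Complex.Gamma b * hypCoeff A B n := by
    intro n
    have e1 := Complex.Gamma_add_nat_div_Gamma_eq a ha (n := n)
    have e2 := Complex.Gamma_add_nat_div_Gamma_eq b (hAB.lower _) (n := n)
    rw [div_eq_iff hΓa] at e1
    rw [div_eq_iff hΓb] at e2
    have e3 : ∏ i, (ascPochhammer ℂ n).eval (A i) =
        (ascPochhammer ℂ n).eval a * ∏ i, (ascPochhammer ℂ n).eval (A' i) :=
      Fin.prod_univ_succAbove _ p
    have e4 : ∏ j, (ascPochhammer ℂ n).eval (B j) =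
        (∏ j, (ascPochhammer ℂ n).eval (B' j)) * (ascPochhammer ℂ n).eval b :=
      Fin.prod_univ_castSucc _
    rw [show a + n + (b - a) = b + n by ring, e1, e2, hypCoeff, hypCoeff, e3, e4]
    have h1 : (ascPochhammer ℂ n).eval b ≠ 0 := ascPochhammer_eval_ne_zero (hAB.lower _) n
    have h3 : (n.factorial : ℂ) ≠ 0 := by exact_mod_cast n.factorial_ne_zero
    have h4 : ∏ j, (ascPochhammer ℂ n).eval (B' j) ≠ 0 :=
      Finset.prod_ne_zero_iff.2 fun j _ => ascPochhammer_eval_ne_zero (hAB'.lower j) n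
    field_simp
  have hc' := convergesOnDisc_hypCoeff A' hAB'.lower
  have hEuler := eqOn_strip
    (differentiableOn_eulerIntegral hp hba hc' h'.diff h'.left)
    (h.diff.const_mul (Complex.Gamma a * Complex.Gamma (b - a) / Complex.Gamma b))
    fun u hu hre => by
      rw [h.left u hu hre, ← powerSum_const_mul]
      simp only [← hcoef]
      rw [← eulerIntegral_powerSum hp hba hc' hre]
      refine setIntegral_congr_fun measurableSet_Ioo fun t ht => ?_
      have : (u + (Real.log t : ℂ)).re < 0 := by
        rw [Complex.add_re, Complex.ofReal_re]
        have := Real.log_neg ht.1 ht.2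
        linarith
      simp only [h'.left _ (add_log_mem_strip hu t) this]
  obtain ⟨C, hC0, hC⟩ := h'.exists_bound hAB' hk'
  have l1 := tendsto_eulerIntegral h'.diff.continuousOn hp hba hpk (h'.tendsto_coeff hAB' hk')
    hC0 hC
  have l2 := (h.tendsto_coeff hAB hk).const_mul
    (Complex.Gamma a * Complex.Gamma (b - a) / Complex.Gamma b)
  have l3 := tendsto_nhds_unique (l1.congr fun s =>
    (congrArg _ (hEuler (ofReal_mem_strip s))).trans (mul_left_comm _ _ _)) l2
  rw [ih d' Φ' h', show a - A' k + (b - a) = b - A' k by ring] at l3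
  have hΓ : Complex.Gamma (b - A' k) ≠ 0 :=
    Complex.Gamma_ne_zero_of_re_pos (by rw [Complex.sub_re]; linarith)
  have hcc : connCoeff A B (p.succAbove k) = connCoeff A' B' k *
      (Complex.Gamma b / Complex.Gamma (b - A' k)) *
      (Complex.Gamma (a - A' k) / Complex.Gamma a) := by
    rw [connCoeff, connCoeff, Fin.prod_univ_castSucc (n := q)]
    have e : Finset.univ.erase (p.succAbove k) =
        insert p ((Finset.univ.erase k).map p.succAboveEmb) := by
      ext i
      rcases Fin.eq_self_or_eq_succAbove p i with rfl | ⟨i, rfl⟩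
      · simp
      · simp [Fin.succAbove_ne]
    rw [e, Finset.prod_insert (by simp [Fin.succAbove_ne]), Finset.prod_map]
    simp only [Fin.coe_succAboveEmb, hA', hB']
    ring
  rw [hcc]
  field_simp at l3 ⊢
  linear_combination -l3

/-- The series without lower parameters is the binomial series. -/
theorem powerSum_binomial (A : Fin 1 → ℂ) (B : Fin 0 → ℂ) {w : ℂ} (hw : ‖w‖ < 1) :
    powerSum (hypCoeff A B) w = (1 - w) ^ (-A 0) := by
  have h := (Complex.one_div_one_sub_cpow_hasFPowerSeriesOnBall_zero (A 0)).hasSum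
    (y := w) (by simpa [Metric.mem_eball, enorm_eq_nnnorm, ← NNReal.coe_lt_coe] using hw)
  rw [Complex.cpow_neg, ← one_div, powerSum]
  rw [zero_add] at h
  rw [← h.tsum_eq]
  refine tsum_congr fun n => ?_
  have h3 : (n.factorial : ℂ) ≠ 0 := by exact_mod_cast n.factorial_ne_zero
  have h4 := Ring.factorial_nsmul_multichoose_eq_ascPochhammer (A 0) n
  rw [Polynomial.ascPochhammer_smeval_eq_eval, nsmul_eq_mul] at h4
  have h5 : Ring.choose (A 0 + n - 1) n = Ring.multichoose (A 0) n := by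
    rw [Ring.choose]
    ring_nf
  simp [hypCoeff, h5, ← h4]
  field_simp

/-- For `q = 0` the function is `(1 - y)^(-A_0)`, and the coefficient is `1`. -/
theorem connectionFormula_zero {A : Fin 1 → ℂ} {B : Fin 0 → ℂ} (hAB : NonResonant A B) :
    ConnectionFormula A B 0 := by
  intro d Φ h
  have hd : DifferentiableOn ℂ (fun u => (1 + Complex.exp u) ^ (-A 0)) strip := fun u hu =>
    (DifferentiableAt.cpow_const (f := fun u => 1 + Complex.exp u) (by fun_prop)
      (one_add_exp_mem_slitPlane hu)).differentiableWithinAt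
  have e := eqOn_strip h.diff hd fun u hu hre => by
    rw [h.left u hu hre, powerSum_binomial A B (norm_neg_exp_lt_one hre), sub_neg_eq_add]
  have l1 := h.tendsto_coeff hAB (k := 0) fun i hi => absurd (Fin.fin_one_eq_zero i) hi
  have l2 : Tendsto (fun t : ℝ => Complex.exp (A 0 * t) * Φ t) atTop (𝓝 1) := by
    have h1 : Tendsto (fun t : ℝ => 1 + Complex.exp (-t : ℝ)) atTop (𝓝 (1 + ((0 : ℝ) : ℂ))) := by
      refine tendsto_const_nhds.add ?_
      simp only [← Complex.ofReal_exp]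
      exact (Complex.continuous_ofReal.tendsto 0).comp Real.tendsto_exp_neg_atTop_nhds_zero
    have h2 : ContinuousAt (fun z : ℂ => z ^ (-A 0)) (1 + ((0 : ℝ) : ℂ)) := by
      refine ContinuousAt.cpow continuousAt_id continuousAt_const ?_
      simp
    have h3 := h2.tendsto.comp h1
    simp only [Complex.ofReal_zero, add_zero, Complex.one_cpow] at h3
    refine h3.congr fun t => ?_
    rw [e (ofReal_mem_strip t), Function.comp_apply]
    beta_reduce
    have e1 : 1 + Complex.exp (t : ℂ) = ((Real.exp t : ℝ) : ℂ) * ((1 + Real.exp (-t) : ℝ) : ℂ) := by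
      rw [← Complex.ofReal_mul, mul_add, ← Real.exp_add]
      simp [add_comm]
    have e2 : 1 + Complex.exp (-t : ℝ) = ((1 + Real.exp (-t) : ℝ) : ℂ) := by simp
    rw [e1, e2, Complex.mul_cpow_ofReal_nonneg (Real.exp_pos t).le (by positivity),
      Complex.cpow_def_of_ne_zero (x := (Real.exp t : ℝ)) (by exact_mod_cast (Real.exp_pos t).ne'),
      ← Complex.ofReal_log (Real.exp_pos t).le, Real.log_exp, ← mul_assoc, ← Complex.exp_add]
    simp [mul_comm]
  rw [tendsto_nhds_unique l1 l2, connCoeff]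
  simp

/-- The connection formula on the slit plane. -/
theorem NonResonant.connectionFormula (hAB : NonResonant A B) (k : Fin (q + 1)) :
    ConnectionFormula A B k := by
  induction q with
  | zero =>
    rw [Fin.fin_one_eq_zero k]
    exact connectionFormula_zero hAB
  | succ q ih =>
    -- the parameter `A_p` is split off; the others are first moved to the right of `A_k`, and then
    -- the last of the `B_j` to the right of `A_p`
    obtain ⟨p, hp⟩ := exists_ne k
    refine shift_induction (p := fun a => a k = A k → NonResonant a B → ConnectionFormula a B k)
      (Finset.univ.erase k) (max ((A k).re + 1) 1) ?_ ?_ A rfl hAB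
    · intro a ha hak hab
      refine shift_induction (p := fun b => NonResonant a b → ConnectionFormula a b k)
        {Fin.last q} ((a p).re + 1) ?_ ?_ B hab
      · intro b hb hab
        obtain ⟨k, rfl⟩ := Fin.exists_succAbove_eq hp.symm
        have hb' := hb _ (Finset.mem_singleton_self _)
        have hmax : ∀ i, i ≠ p.succAbove k → (a (p.succAbove k)).re + 1 ≤ (a i).re ∧
            1 ≤ (a i).re := fun i hi => by
          have := ha i (Finset.mem_erase.2 ⟨hi, Finset.mem_univ i⟩)
          rw [← hak] at this
          exact max_le_iff.1 this
        refine connectionFormula_of_succAbove hab (ih ⟨fun j => hab.lower _,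
          fun i j hij => hab.diff _ _ (Fin.succAbove_right_injective.ne hij)⟩ k)
          (fun i hi => by linarith [(hmax i hi).1]) ?_ (by linarith)
        linarith [(hmax p (Fin.succAbove_ne p k).symm).2]
      · intro b j _ h hab
        exact ConnectionFormula.of_update_lower hab (h (hab.update_lower j))
    · intro a i hi h hak hab
      have hki : k ≠ i := (Finset.ne_of_mem_erase hi).symm
      exact ConnectionFormula.of_update_upper hab hki
        (h (by rw [Function.update_of_ne hki, hak]) (hab.update_upper i))

end Coefficients

/-! ### Continuation along a deformation of the negative real axis -/

section Continuation

variable {q : ℕ} {A : Fin (q + 1) → ℂ} {B : Fin q → ℂ}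

/-- A section of the local system of solutions along `ρ` that begins with the hypergeometric
series is an analytic continuation of it. -/
theorem FlatAlong.exists_isContinuationAlong (hB : ∀ j, ∀ m : ℕ, B j ≠ -m) {ρ : ℝ → ℂ}
    (hρ : Continuous ρ) (hreg : ∀ t, ρ t ∈ regularPoints) {σ : ℝ → Fin (q + 1) → ℂ}
    (hσ : FlatAlong (hypEq A B) ρ σ)
    (hinit : ∀ᶠ t in atBot, ‖ρ t‖ < 1 ∧ σ t = fun m : Fin (q + 1) => zeroJet A B m (ρ t)) :
    ∃ F, IsContinuationAlong (genHyp A B) ρ F ∧ ∀ t, F t (ρ t) = σ t 0 := by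
  have hcont : ContinuousOn (hypEq A B) regularPoints :=
    (differentiableOn_hypSystem _ _ _).continuousOn
  choose Y hY hσY using hσ
  refine ⟨fun t z => Y t z 0, ⟨fun t => ?_, fun t => ?_, ?_⟩, fun t => ?_⟩
  · refine Complex.analyticAt_iff_eventually_differentiableAt.2 ?_
    filter_upwards [hY t] with z hz
    exact differentiableAt_pi.1 hz.differentiableAt 0
  · filter_upwards [hσY t, hρ.continuousAt.eventually (hY t).eventually_nhds] with s hs hs'
    have := (eventually_eq_iff_of_solvesAt isOpen_regularPoints hcont (hreg s)
      (hY s) hs').self_of_nhds.2 ((hσY s).self_of_nhds.symm.trans hs)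
    filter_upwards [this] with z hz
    rw [hz]
  · filter_upwards [hinit] with t ht
    have hZ : ∀ᶠ z in 𝓝 (ρ t),
        SolvesAt (hypEq A B) (fun z (m : Fin (q + 1)) => zeroJet A B m z) z := by
      filter_upwards [isOpen_ne.mem_nhds (hreg t).1,
        (isOpen_lt continuous_norm continuous_const).mem_nhds ht.1] with z hz0 hz1
      exact solvesAt_zeroJet A hB hz0 hz1
    have := (eventually_eq_iff_of_solvesAt isOpen_regularPoints hcont (hreg t)
      (hY t) hZ).self_of_nhds.2 ((hσY t).self_of_nhds.symm.trans ht.2)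
    filter_upwards [this] with z hz
    rw [hz, genHyp_eq_powerSum A hB]
    simp [zeroJet]
  · rw [(hσY t).self_of_nhds]

/-- Two continuations along the same path agree, by the identity theorem. -/
theorem _root_.IsContinuationAlong.eventuallyEq {f : ℂ → ℂ} {ρ : ℝ → ℂ} (hρ : Continuous ρ)
    {F G : ℝ → ℂ → ℂ} (hF : IsContinuationAlong f ρ F) (hG : IsContinuationAlong f ρ G) (t : ℝ) :
    F t =ᶠ[𝓝 (ρ t)] G t := by
  have key : ∀ t, ∀ᶠ s in 𝓝 t, (F s =ᶠ[𝓝 (ρ s)] G s ↔ F t =ᶠ[𝓝 (ρ t)] G t) := by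
    intro t
    obtain ⟨r, hr, hFr⟩ := (hF.analytic t).exists_ball_analyticOnNhd
    obtain ⟨r', hr', hGr⟩ := (hG.analytic t).exists_ball_analyticOnNhd
    have hm : 0 < min r r' := lt_min hr hr'
    have hFm := hFr.mono (Metric.ball_subset_ball (min_le_left r r'))
    have hGm := hGr.mono (Metric.ball_subset_ball (min_le_right r r'))
    have hpre := (convex_ball (ρ t) (min r r')).isPreconnected
    filter_upwards [hF.compat t, hG.compat t,
      hρ.continuousAt.eventually (Metric.ball_mem_nhds (ρ t) hm)] with s hs1 hs2 hs
    have e : F s =ᶠ[𝓝 (ρ s)] G s ↔ F t =ᶠ[𝓝 (ρ s)] G t :=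
      ⟨fun h => hs1.symm.trans (h.trans hs2), fun h => hs1.trans (h.trans hs2.symm)⟩
    rw [e]
    exact ⟨fun h => (hFm.eqOn_of_preconnected_of_eventuallyEq hGm hpre hs h).eventuallyEq_of_mem
        (Metric.ball_mem_nhds _ hm),
      fun h => (hFm.eqOn_of_preconnected_of_eventuallyEq hGm hpre (Metric.mem_ball_self hm)
        h).eventuallyEq_of_mem (Metric.isOpen_ball.mem_nhds hs)⟩
  have hclopen : IsClopen {t | F t =ᶠ[𝓝 (ρ t)] G t} := by
    refine ⟨isOpen_compl_iff.1 (isOpen_iff_mem_nhds.2 fun t ht => ?_),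
      isOpen_iff_mem_nhds.2 fun t ht => ?_⟩
    · filter_upwards [key t] with s hs using fun h => ht (hs.1 h)
    · filter_upwards [key t] with s hs using hs.2 ht
  obtain ⟨t₀, h1, h2⟩ := (hF.init.and hG.init).exists
  exact (hclopen.eq_univ ⟨t₀, h1.trans h2.symm⟩).ge (Set.mem_univ t)

/-- The retraction of the plane to `[0, 1] × ℝ`. Composition with it makes the plane, which is
simply connected and locally path connected, the domain of a deformation. -/
noncomputable def retract (x : ℝ × ℝ) : ℝ × ℝ :=
  (Set.projIcc 0 1 zero_le_one x.1, x.2)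

theorem continuous_retract : Continuous retract :=
  (continuous_subtype_val.comp (continuous_projIcc.comp continuous_fst)).prodMk continuous_snd

theorem retract_mem (x : ℝ × ℝ) : retract x ∈ Set.Icc (0 : ℝ) 1 ×ˢ (Set.univ : Set ℝ) :=
  ⟨(Set.projIcc 0 1 zero_le_one x.1).2, Set.mem_univ _⟩

theorem retract_of_mem {s : ℝ} (hs : s ∈ Set.Icc (0 : ℝ) 1) (t : ℝ) : retract (s, t) = (s, t) := by
  simp [retract, Set.projIcc_of_mem zero_le_one hs]

variable {ρ : ℝ → ℂ} {H : ℝ × ℝ → ℂ}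

theorem _root_.IsDeformation.continuous_comp_retract (hH : IsDeformation ρ H) :
    Continuous (H ∘ retract) :=
  hH.cont.comp_continuous continuous_retract retract_mem

theorem _root_.IsDeformation.mem_regularPoints (hH : IsDeformation ρ H) (x : ℝ × ℝ) :
    H (retract x) ∈ regularPoints :=
  ⟨hH.ne_zero _ (retract_mem x).1 _, hH.ne_one _ (retract_mem x).1 _⟩

theorem _root_.IsDeformation.exists_norm_lt_one (hH : IsDeformation ρ H) :
    ∃ T, ∀ x : ℝ × ℝ, x.2 < T → ‖H (retract x)‖ < 1 := by
  have h1 := hH.start.norm.eventually_lt_const (u := 1) (by simp)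
  obtain ⟨T, hT⟩ := eventually_atBot.1 (eventually_prod_principal_iff.1
    (eventually_swap_iff.1 h1))
  exact ⟨T, fun x hx => hT x.2 hx.le _ (retract_mem x).1⟩

theorem _root_.IsDeformation.exists_one_lt_norm (hH : IsDeformation ρ H) :
    ∃ T, ∀ x : ℝ × ℝ, T < x.2 → 1 < ‖H (retract x)‖ := by
  have h1 := (tendsto_norm_cobounded_atTop.comp hH.finish).eventually_gt_atTop 1
  obtain ⟨T, hT⟩ := eventually_atTop.1 (eventually_prod_principal_iff.1
    (eventually_swap_iff.1 h1))
  exact ⟨T, fun x hx => hT x.2 hx.le _ (retract_mem x).1⟩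

theorem _root_.IsDeformation.comp_retract_zero (hH : IsDeformation ρ H) (t : ℝ) :
    H (retract (0, t)) = -Complex.exp t := by
  rw [retract_of_mem (by simp), hH.init]

theorem _root_.IsDeformation.comp_retract_one (hH : IsDeformation ρ H) (t : ℝ) :
    H (retract (1, t)) = ρ t := by
  rw [retract_of_mem (by simp), hH.term]

/-- The branch of the logarithm exists because the plane is simply connected. -/
theorem _root_.IsDeformation.exists_log (hH : IsDeformation ρ H) :
    ∃ ℓ : ℝ × ℝ → ℂ, Continuous ℓ ∧ (∀ x, Complex.exp (ℓ x) = -H (retract x)) ∧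
      ∀ t : ℝ, ℓ (0, t) = t := by
  have hne : ∀ x, -H (retract x) ∈ ({0}ᶜ : Set ℂ) := fun x =>
    neg_ne_zero.2 (hH.mem_regularPoints x).1
  obtain ⟨ℓ, ⟨hℓ0, hℓ⟩, -⟩ := Complex.isCoveringMapOn_exp.existsUnique_continuousMap_lifts
    (⟨fun x => -H (retract x), hH.continuous_comp_retract.neg⟩ : C(ℝ × ℝ, ℂ))
    (a₀ := ((0, 0) : ℝ × ℝ)) (e₀ := (0 : ℂ))
    (by change Complex.exp 0 = -H (retract (0, 0)); rw [hH.comp_retract_zero]; simp) hne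
  have hexp : ∀ x, Complex.exp (ℓ x) = -H (retract x) := fun x => congrFun hℓ x
  refine ⟨ℓ, ℓ.continuous, hexp, fun t => ?_⟩
  obtain ⟨g, -, hg⟩ := Complex.isCoveringMapOn_exp.existsUnique_continuousMap_lifts
    (⟨fun t : ℝ => Complex.exp t, by fun_prop⟩ : C(ℝ, ℂ)) (a₀ := (0 : ℝ)) (e₀ := (0 : ℂ))
    (by simp) fun t => Complex.exp_ne_zero _
  have h1 := hg ⟨fun t => ℓ (0, t), by fun_prop⟩ ⟨hℓ0, funext fun t => by
    simp [hexp, hH.comp_retract_zero]⟩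
  have h2 := hg ⟨fun t => (t : ℂ), by fun_prop⟩ ⟨by simp, rfl⟩
  exact DFunLike.congr_fun (h1.trans h2.symm) t

/-- Along a deformation, the section that begins with the hypergeometric series ends with the
combination of the solutions at infinity that is known from the negative real axis. -/
theorem NonResonant.exists_flatAlong_deformation (hAB : NonResonant A B) (hH : IsDeformation ρ H)
    {ℓ : ℝ × ℝ → ℂ} (hℓ : Continuous ℓ) (hexp : ∀ x, Complex.exp (ℓ x) = -H (retract x))
    (hℓ0 : ∀ t : ℝ, ℓ (0, t) = t) :
    ∃ σ : ℝ × ℝ → Fin (q + 1) → ℂ, FlatAlong (hypEq A B) (H ∘ retract) σ ∧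
      (∃ T, ∀ x : ℝ × ℝ, x.2 < T → ‖H (retract x)‖ < 1 ∧
        σ x = fun m : Fin (q + 1) => zeroJet A B m (H (retract x))) ∧
      ∃ T, ∀ x : ℝ × ℝ, T < x.2 → 0 < (ℓ x).re ∧
        σ x = ∑ k, connCoeff A B k • fun m : Fin (q + 1) => infJet A B k m (ℓ x) := by
  have hcont : ContinuousOn (hypEq A B) regularPoints :=
    (differentiableOn_hypSystem _ _ _).continuousOn
  obtain ⟨d, τ, hτ, hτl, hτr⟩ := hAB.exists_flatAlong_strip
  obtain ⟨Φ, hΦ⟩ := isConnection_of_flatAlong hτ hτl hτr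
  obtain rfl : d = connCoeff A B := funext fun k => hAB.connectionFormula k d Φ hΦ
  obtain ⟨T₁, hT₁⟩ := hH.exists_norm_lt_one
  obtain ⟨T₂, hT₂⟩ := hH.exists_one_lt_norm
  have hre : ∀ x : ℝ × ℝ, T₂ < x.2 → 0 < (ℓ x).re := fun x hx => by
    have := hT₂ x hx
    rwa [← norm_neg, ← hexp, Complex.norm_exp, Real.one_lt_exp_iff] at this
  set t₁ := T₁ - 1 with ht₁
  have ht₁T : t₁ < T₁ := by linarith
  set t₂ := T₂ + 1 with ht₂
  have ht₂T : T₂ < t₂ := by linarith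
  have ht₁0 : t₁ < 0 := by
    have := hT₁ (0, t₁) ht₁T
    rwa [hH.comp_retract_zero, norm_neg, Complex.norm_exp, Complex.ofReal_re,
      Real.exp_lt_one_iff] at this
  have ht₂0 : 0 < t₂ := by simpa [hℓ0] using hre (0, t₂) ht₂T
  obtain ⟨σ, hσ, hσ0⟩ := exists_flatAlong (M := hypEq A B) isOpen_regularPoints
    (differentiableOn_hypSystem _ _ _) hH.continuous_comp_retract
    hH.mem_regularPoints (0, t₁) fun m : Fin (q + 1) => zeroJet A B m (H (retract (0, t₁)))
  refine ⟨σ, hσ, ⟨T₁, fun x hx => ⟨hT₁ x hx, ?_⟩⟩, T₂, fun x hx => ⟨hre x hx, ?_⟩⟩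
  · let S : Set (ℝ × ℝ) := {x | x.2 < T₁}
    have : PreconnectedSpace S := Subtype.preconnectedSpace
      ((convex_Iio T₁).linear_preimage (LinearMap.snd ℝ ℝ ℝ)).isPreconnected
    have := (hσ.comp (continuous_subtype_val (p := (· ∈ S)))).eq isOpen_regularPoints hcont
      (hH.continuous_comp_retract.comp continuous_subtype_val)
      (fun x => hH.mem_regularPoints x.1)
      (flatAlong_zeroJet hAB.lower (fun x => (hH.mem_regularPoints x).1) fun x : S => hT₁ x x.2)
      (t₀ := ⟨(0, t₁), ht₁T⟩) hσ0
    exact congrFun this ⟨x, hx⟩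
  · -- along the negative real axis, the section is the one on the slit plane
    have hline : ∀ t : ℝ, σ (0, t) = τ ⟨t, ofReal_mem_strip t⟩ := by
      have e : (H ∘ retract) ∘ (fun t : ℝ => ((0, t) : ℝ × ℝ)) = fun t : ℝ => -Complex.exp t :=
        funext hH.comp_retract_zero
      have h1 := hσ.comp (f := fun t : ℝ => ((0, t) : ℝ × ℝ)) (by fun_prop)
      rw [e] at h1
      have h2 := hτ.comp (f := fun t : ℝ => (⟨t, ofReal_mem_strip t⟩ : strip)) (by fun_prop)
      have := h1.eq isOpen_regularPoints hcont (by fun_prop)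
        (fun t => neg_exp_mem_regularPoints_of_mem_strip (ofReal_mem_strip t)) h2 (t₀ := t₁) (by
          simp only [Function.comp_apply]
          rw [hσ0, hτl _ (by simpa using ht₁0), hH.comp_retract_zero])
      exact congrFun this
    -- so it is the expected combination at the point `(0, t₂)`, hence wherever `H` is large
    let S : Set (ℝ × ℝ) := {x | T₂ < x.2}
    have : PreconnectedSpace S := Subtype.preconnectedSpace
      ((convex_Ioi T₂).linear_preimage (LinearMap.snd ℝ ℝ ℝ)).isPreconnected
    have e : (H ∘ retract) ∘ (Subtype.val : S → ℝ × ℝ) = fun x : S => -Complex.exp (ℓ x) :=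
      funext fun x => by simp [hexp]
    have h1 := hσ.comp (continuous_subtype_val (p := (· ∈ S)))
    rw [e] at h1
    have := h1.eq isOpen_regularPoints hcont (by fun_prop)
      (fun x : S => neg_exp_mem_regularPoints (hre x.1 x.2).ne')
      (FlatAlong.linearCombination (fun k => hAB.flatAlong_infJet k
        (hℓ.comp continuous_subtype_val) fun x : S => hre x.1 x.2) (connCoeff A B))
      (t₀ := (⟨(0, t₂), ht₂T⟩ : S)) (by
        simp only [Function.comp_apply]
        rw [hline, hτr _ (by simpa using ht₂0), hℓ0])
    exact congrFun this ⟨x, hx⟩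

/-- The continuation along `ρ` and its expansion at the end of `ρ`. -/
theorem NonResonant.exists_isContinuationAlong (hAB : NonResonant A B) (hρ : Continuous ρ)
    (hH : IsDeformation ρ H) {ℓ : ℝ × ℝ → ℂ} (hℓ : Continuous ℓ)
    (hexp : ∀ x, Complex.exp (ℓ x) = -H (retract x)) (hℓ0 : ∀ t : ℝ, ℓ (0, t) = t) :
    ∃ F, IsContinuationAlong (genHyp A B) ρ F ∧ ∀ᶠ t in atTop, F t (ρ t) =
      ∑ k, connCoeff A B k * Complex.exp (-A k * ℓ (1, t)) *
        powerSum (infCoeff A B k) (1 / ρ t) := by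
  obtain ⟨σ, hσ, ⟨T₁, hT₁⟩, T₂, hT₂⟩ := hAB.exists_flatAlong_deformation hH hℓ hexp hℓ0
  have h1 := hσ.comp (f := fun t : ℝ => ((1, t) : ℝ × ℝ)) (by fun_prop)
  have e : (H ∘ retract) ∘ (fun t : ℝ => ((1, t) : ℝ × ℝ)) = ρ := funext hH.comp_retract_one
  rw [e] at h1
  obtain ⟨F, hF, hFσ⟩ := h1.exists_isContinuationAlong hAB.lower hρ
    (fun t => hH.comp_retract_one t ▸ hH.mem_regularPoints (1, t)) (by
      filter_upwards [eventually_lt_atBot T₁] with t ht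
      simpa only [hH.comp_retract_one, Function.comp_apply] using hT₁ (1, t) ht)
  refine ⟨F, hF, ?_⟩
  filter_upwards [eventually_gt_atTop T₂] with t ht
  have e1 : -Complex.exp (-ℓ (1, t)) = 1 / ρ t := by
    rw [Complex.exp_neg, hexp, hH.comp_retract_one, one_div, inv_neg, neg_neg]
  rw [hFσ, Function.comp_apply, (hT₂ (1, t) ht).2]
  simp only [Finset.sum_apply, Pi.smul_apply, smul_eq_mul, Fin.val_zero, infJet_order_zero, e1,
    mul_assoc]

end Continuation

end GenHyp

theorem mainTheorem10 (q : ℕ) (A : Fin (q + 1) → ℂ) (B : Fin q → ℂ)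
    (hB : ∀ j, ∀ m : ℕ, B j ≠ -m)
    (hA : ∀ i j, i ≠ j → ∀ m : ℤ, A i - A j ≠ m) :
    ∃ ε : Fin (q + 1) → ℂ → ℂ,
      (∀ k, AnalyticAt ℂ (ε k) 0 ∧ ε k =O[𝓝 0] (fun w => w)) ∧
      ∀ ρ : ℝ → ℂ, IsPathZeroInfty ρ → HasTrivialWinding ρ →
        (∃ F, IsContinuationAlong (genHyp A B) ρ F) ∧
        (∃ L, IsLogNegBranch ρ L) ∧
        ∀ F L, IsContinuationAlong (genHyp A B) ρ F → IsLogNegBranch ρ L →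
          ∀ᶠ t in atTop, F t (ρ t) =
            ∑ k, connCoeff A B k * Complex.exp (-A k * L t) * (1 + ε k (1 / ρ t)) := by
  have hAB : GenHyp.NonResonant A B := ⟨hB, hA⟩
  refine ⟨fun k w => GenHyp.powerSum (GenHyp.infCoeff A B k) w - 1, fun k => ?_, ?_⟩
  · have hd : ∀ w : ℂ, ‖w‖ < 1 → HasDerivAt (GenHyp.powerSum (GenHyp.infCoeff A B k)) _ w :=
      fun w hw => GenHyp.hasDerivAt_powerSum (hAB.convergesOnDisc_infCoeff k) hw
    refine ⟨AnalyticAt.sub (Complex.analyticAt_iff_eventually_differentiableAt.2 ?_)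
      analyticAt_const, ?_⟩
    · filter_upwards [Metric.ball_mem_nhds (0 : ℂ) one_pos] with w hw
      exact (hd w (by simpa using hw)).differentiableAt
    · have := (hd 0 (by simp)).isBigO_sub
      simpa [GenHyp.powerSum_zero, GenHyp.infCoeff_zero] using this
  intro ρ hρ hw
  refine ⟨?_, ?_, fun F L hF hL => ?_⟩
  · obtain ⟨H, hH⟩ := hw
    obtain ⟨ℓ, hℓ, hexp, hℓ0⟩ := hH.exists_log
    obtain ⟨F, hF, -⟩ := hAB.exists_isContinuationAlong hρ.cont hH hℓ hexp hℓ0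
    exact ⟨F, hF⟩
  · obtain ⟨H, hH⟩ := hw
    obtain ⟨ℓ, hℓ, hexp, hℓ0⟩ := hH.exists_log
    refine ⟨fun t => ℓ (1, t), H, ℓ, hH, hℓ.continuousOn, fun s hs t => ?_, hℓ0, fun t => rfl⟩
    rw [hexp, GenHyp.retract_of_mem hs]
  · obtain ⟨H, ℓ, hH, hℓ, hexp, hℓ0, hℓL⟩ := hL
    have hr := fun t => GenHyp.retract_of_mem (s := 1) (by simp) t
    obtain ⟨G, hG, hGe⟩ := hAB.exists_isContinuationAlong hρ.cont hH
      (ℓ := ℓ ∘ GenHyp.retract)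
      (hℓ.comp_continuous GenHyp.continuous_retract GenHyp.retract_mem)
      (fun x => hexp _ (GenHyp.retract_mem x).1 _)
      fun t => by rw [Function.comp_apply, GenHyp.retract_of_mem (by simp), hℓ0]
    filter_upwards [hGe] with t ht
    rw [(hF.eventuallyEq hρ.cont hG t).self_of_nhds, ht]
    simp only [Function.comp_apply, hr, hℓL, add_sub_cancel]
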